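/- Let $k\ge 0$ be an integer, let $b:\mathbb R\to\mathbb R$ be $1$-periodic and of class $\mathcal C^{2k+2}$, and for $x\in\mathbb R$ let $y_x$ be the solution of $\dot y(t)=b(y(t))$, $t\in\mathbb R$, $y(0)=x$. Let $v_0:\mathbb R\to\mathbb R$ be $1$-periodic and of class $\mathcal C^{k+1}$. For $T>0$ let $v$ be the solution, $1$-periodic in $x$, of $$v_t+b(x)v_x=0 \ \text{ on } (0,T)\times\mathbb R,\qquad v(0,\cdot)=v_0 .$$ *Discretization.* Let $N,M\ge 1$ be integers, $\Delta t=T/N$, $\Delta x=1/M$, $t_n=n\Delta t$, $v^n=v(t_n,\cdot)$. Let $V_k$ be the space of functions on $(0,1)$, extended $1$-periodically, whose restriction to each cell $I_i=(i\Delta x,(i+1)\Delta x)$, $0\le i<M$, is a polynomial of degree at most $k$. Let $(x_\alpha)_{0\le\alpha\le k}\subset(-1,1)$ and $(w_\alpha)_{0\le\alpha\le k}$, $w_\alpha>0$, be the Gauss points and weights on $(-1,1)$, so that $\int_{-1}^1p=\sum_\alpha w_\alpha p(x_\alpha)$ for all polynomials $p$ of degree at most $2k+1$. For each $i$ let $i\Delta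 x=x_{i,0}<x_{i,1}<\dots<x_{i,p_i}<x_{i,p_i+1}=(i+1)\Delta x$, where $x_{i,1},\dots,x_{i,p_i}$ are the (finitely many) points $x\in I_i$ with $y_x(-\Delta t)\in\Delta x\,\mathbb Z$, and set $$\tilde w^i_{q,\alpha}=\tfrac{w_\alpha}{2}(x_{i,q+1}-x_{i,q}),\qquad \tilde x^i_{q,\alpha}=x_{i,q}+\tfrac12(1+x_\alpha)(x_{i,q+1}-x_{i,q}).$$ The implementable semi-Lagrangian discontinuous Galerkin scheme is: $u^0\in V_k$ is given and, for $0\le n<N$, $u^{n+1}$ is the element of $V_k$ such that $$\int_0^1u^{n+1}\varphi\,dx=\sum_{i=0}^{M-1}\sum_{q=0}^{p_i}\sum_{\alpha=0}^k\tilde w^i_{q,\alpha}\,u^n\big(y_{\tilde x^i_{q,\alpha}}(-\Delta t)\big)\,\varphi(\tilde x^i_{q,\alpha})\qquad\forall\varphi\in V_k .$$ **Theorem (convergence).** There exist a constant $C_1\ge0$ depending only on $k$ and $b$, and a constant $C\ge0$ depending only on $k$, $b$ and $v_0$, such that for all $T>0$, all $N,M\ge1$ (without any condition relating $\Delta t$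 and $\Delta x$) and all $u^0\in V_k$, $$\|u^n-v^n\|_{L^2(0,1)}\le e^{C_1T}\Big(\|u^0-v^0\|_{L^2(0,1)}+C\,T\,\frac{\Delta x^{k+1}}{\Delta t}\Big)\qquad\text{for all } 0\le n\le N .$$ -/

import Mathlib

open MeasureTheory

namespace SLDG

/-- `y` solves the characteristic equation `y' = b(y)` on the whole real line, with `y(0) = x`. -/
def IsCharacteristic (b : ℝ → ℝ) (x : ℝ) (y : ℝ → ℝ) : Prop :=
  y 0 = x ∧ ∀ t : ℝ, HasDerivAt y (b (y t)) t

open Classical in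
/-- The characteristic through `x`: `charFlow b x t` is `y_x(t)`, where `y_x` is the solution of
`y' = b(y)`, `y(0) = x`. It exists and is unique for the `b` considered here, see
`isCharacteristic_charFlow` and `IsCharacteristic.eq_charFlow`. -/
noncomputable def charFlow (b : ℝ → ℝ) (x : ℝ) : ℝ → ℝ :=
  if h : ∃ y, IsCharacteristic b x y then h.choose else fun _ => x

theorem exists_bound {b : ℝ → ℝ} (hb : Continuous b) (hper : Function.Periodic b 1) :
    ∃ K : NNReal, ∀ z, ‖b z‖ ≤ K := by
  obtain ⟨C, hC⟩ := isCompact_Icc.exists_bound_of_continuousOn (s := Set.Icc (0 : ℝ) 1)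
    hb.continuousOn
  refine ⟨C.toNNReal, fun z => ?_⟩
  have h1 : b z = b (Int.fract z) := by
    have := hper.sub_int_mul_eq (x := z) ⌊z⌋
    rw [mul_one] at this
    exact this.symm
  rw [h1]
  exact (hC _ ⟨Int.fract_nonneg z, (Int.fract_lt_one z).le⟩).trans (Real.le_coe_toNNReal C)

theorem exists_lipschitz {b : ℝ → ℝ} (hb : ContDiff ℝ 1 b) (hper : Function.Periodic b 1) :
    ∃ L : NNReal, LipschitzWith L b := by
  have hper' : Function.Periodic (deriv b) 1 := by
    intro z
    have h : (fun x => b (x + 1)) = b := funext hper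
    rw [← deriv_comp_add_const, h]
  obtain ⟨L, hL⟩ := exists_bound (hb.continuous_deriv le_rfl) hper'
  exact ⟨L, lipschitzWith_of_nnnorm_deriv_le (hb.differentiable one_ne_zero) fun z => hL z⟩

theorem IsCharacteristic.unique {b : ℝ → ℝ} (hb : ContDiff ℝ 1 b)
    (hper : Function.Periodic b 1) {t : ℝ} {y z : ℝ → ℝ}
    (hy : ∀ s, HasDerivAt y (b (y s)) s) (hz : ∀ s, HasDerivAt z (b (z s)) s)
    (h : y t = z t) : y = z := by
  obtain ⟨L, hL⟩ := exists_lipschitz hb hper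
  exact ODE_solution_unique_univ (v := fun _ => b) (s := fun _ => Set.univ) (K := L)
    (fun _ => hL.lipschitzOnWith) (fun s => ⟨hy s, trivial⟩) (fun s => ⟨hz s, trivial⟩) h

theorem exists_isCharacteristic {b : ℝ → ℝ} (hb : ContDiff ℝ 1 b)
    (hper : Function.Periodic b 1) (x : ℝ) : ∃ y, IsCharacteristic b x y := by
  obtain ⟨K, hK⟩ := exists_bound hb.continuous hper
  obtain ⟨L, hL⟩ := exists_lipschitz hb hper
  have key : ∀ n : ℕ, ∃ y : ℝ → ℝ, y 0 = x ∧ ∀ t ∈ Set.Ioo (-((n : ℝ) + 1)) ((n : ℝ) + 1),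
      HasDerivAt y (b (y t)) t := by
    intro n
    have h0 : (0 : ℝ) ∈ Set.Icc (-((n : ℝ) + 1)) ((n : ℝ) + 1) := by
      constructor <;> linarith [n.cast_nonneg (α := ℝ)]
    have hpl : IsPicardLindelof (fun _ => b) (⟨0, h0⟩ : Set.Icc (-((n : ℝ) + 1)) ((n : ℝ) + 1))
        x (K * ((n : NNReal) + 1)) 0 K L :=
      { lipschitzOnWith := fun _ _ => hL.lipschitzOnWith
        continuousOn := fun _ _ => continuousOn_const
        norm_le := fun _ _ z _ => hK z
        mul_max_le := by simp }
    obtain ⟨y, hy0, hy⟩ := hpl.exists_eq_forall_mem_Icc_hasDerivWithinAt₀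
    exact ⟨y, hy0, fun t ht =>
      (hy t (Set.Ioo_subset_Icc_self ht)).hasDerivAt (Icc_mem_nhds ht.1 ht.2)⟩
  choose Y hY0 hY using key
  have agree : ∀ m n : ℕ, m ≤ n → Set.EqOn (Y m) (Y n)
      (Set.Ioo (-((m : ℝ) + 1)) ((m : ℝ) + 1)) := by
    intro m n hmn
    have hc : (m : ℝ) ≤ n := by exact_mod_cast hmn
    refine ODE_solution_unique_of_mem_Ioo (v := fun _ => b) (s := fun _ => Set.univ) (K := L)
      (t₀ := 0) (fun _ _ => hL.lipschitzOnWith) ?_ (fun t ht => ⟨hY m t ht, trivial⟩)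
      (fun t ht => ⟨hY n t ⟨by linarith [ht.1], by linarith [ht.2]⟩, trivial⟩) ?_
    · constructor <;> linarith [m.cast_nonneg (α := ℝ)]
    · rw [hY0, hY0]
  have fl : ∀ t : ℝ, t ∈ Set.Ioo (-((⌊|t|⌋₊ : ℝ) + 1)) ((⌊|t|⌋₊ : ℝ) + 1) := fun t =>
    abs_lt.mp (Nat.lt_floor_add_one |t|)
  refine ⟨fun t => Y ⌊|t|⌋₊ t, hY0 _, fun t => ?_⟩
  have hloc : ∀ s ∈ Set.Ioo (-((⌊|t|⌋₊ : ℝ) + 1)) ((⌊|t|⌋₊ : ℝ) + 1),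
      Y ⌊|s|⌋₊ s = Y ⌊|t|⌋₊ s := by
    intro s hs
    rcases le_total ⌊|s|⌋₊ ⌊|t|⌋₊ with h | h
    · exact agree _ _ h (fl s)
    · exact (agree _ _ h hs).symm
  exact (hY _ t (fl t)).congr_of_eventuallyEq
    (Filter.eventuallyEq_of_mem (Ioo_mem_nhds (fl t).1 (fl t).2) hloc)

theorem isCharacteristic_charFlow {b : ℝ → ℝ} (hb : ContDiff ℝ 1 b)
    (hper : Function.Periodic b 1) (x : ℝ) : IsCharacteristic b x (charFlow b x) := by
  have h := exists_isCharacteristic hb hper x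
  rw [charFlow, dif_pos h]
  exact h.choose_spec

theorem IsCharacteristic.eq_charFlow {b : ℝ → ℝ} (hb : ContDiff ℝ 1 b)
    (hper : Function.Periodic b 1) {x : ℝ} {y : ℝ → ℝ} (hy : IsCharacteristic b x y) :
    y = charFlow b x :=
  have h := isCharacteristic_charFlow hb hper x
  IsCharacteristic.unique hb hper (t := 0) hy.2 h.2 (by rw [hy.1, h.1])

/-- `v` is a solution on `[0,T]` of `v_t + b(x) v_x = 0`, `v(0,·) = v₀`, with 1-periodic boundary
conditions: continuous up to `t = 0` and `t = T`, and differentiable for `0 < t < T`. -/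
structure IsSolution (b v₀ : ℝ → ℝ) (T : ℝ) (v : ℝ → ℝ → ℝ) : Prop where
  continuousOn : ContinuousOn (fun p : ℝ × ℝ => v p.1 p.2) (Set.Icc 0 T ×ˢ Set.univ)
  periodic : ∀ t ∈ Set.Icc 0 T, Function.Periodic (v t) 1
  differentiableAt : ∀ t ∈ Set.Ioo 0 T, ∀ x : ℝ,
    DifferentiableAt ℝ (fun p : ℝ × ℝ => v p.1 p.2) (t, x)
  equation : ∀ t ∈ Set.Ioo 0 T, ∀ x : ℝ,
    deriv (fun s => v s x) t + b x * deriv (fun z => v t z) x = 0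
  initial : ∀ x : ℝ, v 0 x = v₀ x

/-- The `L²` norm on `(0,1)`. -/
noncomputable def l2Norm (f : ℝ → ℝ) : ℝ :=
  lpNorm f 2 (volume.restrict (Set.Ioo (0 : ℝ) 1))

/-- The space `V_k` on the uniform mesh with `M` cells `(i/M, (i+1)/M)` of `(0,1)`: functions that
are on each open cell a polynomial of degree at most `k`. They are extended 1-periodically to the
real line; the values at the finitely many mesh points of a period are irrelevant. -/
def dgSpace (k M : ℕ) : Submodule ℝ (ℝ → ℝ) where
  carrier := {u | Function.Periodic u 1 ∧ ∀ i < M, ∃ p : Polynomial ℝ, p.natDegree ≤ k ∧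
    ∀ x ∈ Set.Ioo ((i : ℝ) / M) (((i : ℝ) + 1) / M), u x = p.eval x}
  zero_mem' := ⟨fun _ => rfl, fun _ _ => ⟨0, by simp, by simp⟩⟩
  add_mem' := by
    rintro u v ⟨hu, hu'⟩ ⟨hv, hv'⟩
    refine ⟨hu.add hv, fun i hi => ?_⟩
    obtain ⟨p, hp, hup⟩ := hu' i hi
    obtain ⟨q, hq, hvq⟩ := hv' i hi
    exact ⟨p + q, (Polynomial.natDegree_add_le p q).trans (max_le hp hq), fun x hx => by
      rw [Pi.add_apply, Polynomial.eval_add, hup x hx, hvq x hx]⟩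
  smul_mem' := by
    rintro c u ⟨hu, hu'⟩
    refine ⟨hu.smul c, fun i hi => ?_⟩
    obtain ⟨p, hp, hup⟩ := hu' i hi
    exact ⟨c • p, (Polynomial.natDegree_smul_le c p).trans hp, fun x hx => by
      rw [Pi.smul_apply, Polynomial.eval_smul, hup x hx]⟩

/-- `ξ` and `ω` are the nodes and weights of the Gauss quadrature rule with `k + 1` points on
`(-1,1)`, which is exact on polynomials of degree at most `2k + 1`. -/
structure IsGaussRule (k : ℕ) (ξ ω : Fin (k + 1) → ℝ) : Prop where
  node_mem : ∀ α, ξ α ∈ Set.Ioo (-1 : ℝ) 1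
  node_injective : Function.Injective ξ
  weight_pos : ∀ α, 0 < ω α
  exact : ∀ p : Polynomial ℝ, p.natDegree ≤ 2 * k + 1 →
    ∫ x in (-1 : ℝ)..1, p.eval x = ∑ α, ω α * p.eval (ξ α)

/-- The Gauss quadrature of `f` transported to the interval `(a,c)`. -/
noncomputable def gaussSum {k : ℕ} (ξ ω : Fin (k + 1) → ℝ) (a c : ℝ) (f : ℝ → ℝ) : ℝ :=
  ∑ α, ω α / 2 * (c - a) * f (a + (1 + ξ α) / 2 * (c - a))

/-- The points of the open cell `(i/M, (i+1)/M)` at which `x ↦ u(y_x(-Δt))` may fail to be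
regular: those `x` for which the foot `y_x(-Δt)` is a mesh point `ℓ/M`, `ℓ ∈ ℤ`. -/
def breakSet (b : ℝ → ℝ) (dt : ℝ) (M i : ℕ) : Set ℝ :=
  {x | x ∈ Set.Ioo ((i : ℝ) / M) (((i : ℝ) + 1) / M) ∧
    ∃ ℓ : ℤ, charFlow b x (-dt) = (ℓ : ℝ) / M}

theorem finite_breakSet {b : ℝ → ℝ} (hb : ContDiff ℝ 1 b) (hper : Function.Periodic b 1)
    (dt : ℝ) {M : ℕ} (hM : 1 ≤ M) (i : ℕ) : (breakSet b dt M i).Finite := by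
  obtain ⟨K, hK⟩ := exists_bound hb.continuous hper
  have hM' : (0 : ℝ) < M := by exact_mod_cast hM
  have hch := fun x => isCharacteristic_charFlow hb hper x
  have hinj : Function.Injective (fun x => charFlow b x (-dt)) := by
    intro x z h
    have := IsCharacteristic.unique hb hper (hch x).2 (hch z).2 h
    rw [← (hch x).1, ← (hch z).1, this]
  have hdist : ∀ x, |charFlow b x (-dt) - x| ≤ K * |dt| := by
    intro x
    have := Convex.norm_image_sub_le_of_norm_hasDerivWithin_le (s := Set.univ)
      (fun t _ => ((hch x).2 t).hasDerivWithinAt) (fun t _ => hK _) convex_univ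
      (Set.mem_univ 0) (Set.mem_univ (-dt))
    simpa [(hch x).1] using this
  have hfin : (Set.Icc ⌊(i : ℝ) - K * |dt| * M⌋ ⌈(i : ℝ) + 1 + K * |dt| * M⌉).Finite :=
    Set.finite_Icc _ _
  refine Set.Finite.of_finite_image (f := fun x => charFlow b x (-dt)) ?_ hinj.injOn
  refine (hfin.image fun ℓ : ℤ => (ℓ : ℝ) / M).subset ?_
  rintro _ ⟨x, ⟨hx, ℓ, hℓ⟩, rfl⟩
  refine ⟨ℓ, ?_, hℓ.symm⟩
  have h := abs_le.mp (hdist x)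
  rw [hℓ] at h
  have h1 := (div_lt_iff₀ hM').mp hx.1
  have h2 := (lt_div_iff₀ hM').mp hx.2
  have e : (ℓ : ℝ) / M * M = ℓ := div_mul_cancel₀ _ hM'.ne'
  have h3 := mul_le_mul_of_nonneg_right h.1 hM'.le
  have h4 := mul_le_mul_of_nonneg_right h.2 hM'.le
  rw [sub_mul, e] at h3 h4
  constructor
  · exact Int.cast_le.mp ((Int.floor_le _).trans (by linarith : _ ≤ (ℓ : ℝ)))
  · exact Int.cast_le.mp ((by linarith : (ℓ : ℝ) ≤ _).trans (Int.le_ceil _))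

open Classical in
/-- The finite set `{x_{i,0}, …, x_{i,p_i+1}}`: the points of `breakSet` (finitely many, see
`finite_breakSet`) together with the two end points of the cell. -/
noncomputable def cellPoints (b : ℝ → ℝ) (dt : ℝ) (M i : ℕ) : Finset ℝ :=
  {(i : ℝ) / M, ((i : ℝ) + 1) / M} ∪
    if h : (breakSet b dt M i).Finite then h.toFinset else ∅

/-- `x_{i,q}`: the `q`-th element of `cellPoints`, in increasing order, for
`0 ≤ q ≤ p_i + 1`. -/
noncomputable def cellPoint (b : ℝ → ℝ) (dt : ℝ) (M i q : ℕ) : ℝ :=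
  ((cellPoints b dt M i).sort (· ≤ ·)).getD q 0

/-- `(f, g)_G`: the product of `f` and `g` is integrated over `(0,1)` by the Gauss rule on each
of the sub-intervals `(x_{i,q}, x_{i,q+1})`, `0 ≤ i < M`, `0 ≤ q ≤ p_i`; here `p_i + 2` is the
number of elements of `cellPoints`. -/
noncomputable def gaussForm {k : ℕ} (ξ ω : Fin (k + 1) → ℝ) (b : ℝ → ℝ) (dt : ℝ) (M : ℕ)
    (f g : ℝ → ℝ) : ℝ :=
  ∑ i ∈ Finset.range M, ∑ q ∈ Finset.range ((cellPoints b dt M i).card - 1),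
    gaussSum ξ ω (cellPoint b dt M i q) (cellPoint b dt M i (q + 1)) (fun x => f x * g x)

/-- One step of the implementable scheme: `u'` is the element of `V_k` with
`(u', φ) = (u(y_·(-Δt)), φ)_G` for all `φ ∈ V_k`. -/
def IsStep {k : ℕ} (ξ ω : Fin (k + 1) → ℝ) (b : ℝ → ℝ) (dt : ℝ) (M : ℕ)
    (u u' : ℝ → ℝ) : Prop :=
  u' ∈ dgSpace k M ∧ ∀ φ ∈ dgSpace k M,
    ∫ x in (0 : ℝ)..1, u' x * φ x = gaussForm ξ ω b dt M (fun x => u (charFlow b x (-dt))) φ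

end SLDG

/-! Each `u n` is compared with an element `g n` of `V_k` that approximates `v^n` uniformly within
`ε = C e^{dT} Δx^{k+1}`. The Gauss form is exact on `V_k × V_k`, so the scheme gives, for `e_n = u n
- g n`, `∫ e_{n+1} φ = (e_n ∘ Φ, φ)_G + (g_n ∘ Φ - g_{n+1}, φ)_G`, where `Φ x = y_x(-Δt)`. Take `φ =
e_{n+1}` and apply Cauchy–Schwarz for this positive semidefinite form.

Consistency: `v^n ∘ Φ = v^{n+1}`, so the second factor is at most `2ε` at every point.

Stability: on each sub-interval `Φ` maps into one cell, so `e_n ∘ Φ` is a polynomial evaluated at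
displaced Gauss nodes. `Φ` distorts lengths by factors in `[e^{-LΔt}, e^{LΔt}]`, hence moves the
nodes by at most the fraction `e^{2LΔt} - 1` of the image interval (`abs_charFlow_sub_affine_le`),
and this costs a factor `1 + Λη` (`IsGaussRule.exists_sum_sq_le`). The resulting factor `e^{cΔt}`
does not involve `Δx`, so no CFL condition appears.

Thus `‖e_{n+1}‖ ≤ e^{c₁Δt}‖e_n‖ + 2ε` (`IsGaussRule.exists_l2Norm_step_le`), and the `N = T/Δt`
steps accumulate to order `T ε / Δt`. That `ε` grows only like `e^{dT}`, with `d` independent of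
`v₀`, comes from exponential bounds on the `x`-derivatives of the flow
(`exists_expRegular_comp_charFlow`). -/

namespace SLDG

/-! ### The flow of `b`: dependence on the initial point, and the solution by characteristics. -/

section Flow

variable {b : ℝ → ℝ}

theorem charFlow_zero (hb : ContDiff ℝ 1 b) (hper : Function.Periodic b 1) (x : ℝ) :
    charFlow b x 0 = x :=
  (isCharacteristic_charFlow hb hper x).1

theorem hasDerivAt_charFlow (hb : ContDiff ℝ 1 b) (hper : Function.Periodic b 1) (x t : ℝ) :
    HasDerivAt (charFlow b x) (b (charFlow b x t)) t :=
  (isCharacteristic_charFlow hb hper x).2 t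

theorem continuous_charFlow (hb : ContDiff ℝ 1 b) (hper : Function.Periodic b 1) (x : ℝ) :
    Continuous (charFlow b x) :=
  continuous_iff_continuousAt.2 fun t => (hasDerivAt_charFlow hb hper x t).continuousAt

theorem charFlow_add (hb : ContDiff ℝ 1 b) (hper : Function.Periodic b 1) (x s t : ℝ) :
    charFlow b x (s + t) = charFlow b (charFlow b x s) t := by
  have h : IsCharacteristic b (charFlow b x s) (fun t => charFlow b x (s + t)) :=
    ⟨by simp, fun t => (hasDerivAt_charFlow hb hper x (s + t)).comp_const_add s t⟩
  exact congrFun (h.eq_charFlow hb hper) t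

theorem charFlow_add_one (hb : ContDiff ℝ 1 b) (hper : Function.Periodic b 1) (x t : ℝ) :
    charFlow b (x + 1) t = charFlow b x t + 1 := by
  have h : IsCharacteristic b (x + 1) (fun t => charFlow b x t + 1) :=
    ⟨by simp [charFlow_zero hb hper], fun t => by
      simpa [hper _] using (hasDerivAt_charFlow hb hper x t).add_const 1⟩
  exact (congrFun (h.eq_charFlow hb hper) t).symm

theorem charFlow_ne (hb : ContDiff ℝ 1 b) (hper : Function.Periodic b 1) {x z : ℝ}
    (hxz : x ≠ z) (t : ℝ) : charFlow b x t ≠ charFlow b z t := fun h => hxz <| by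
  have := IsCharacteristic.unique hb hper (isCharacteristic_charFlow hb hper x).2
    (isCharacteristic_charFlow hb hper z).2 h
  rw [← charFlow_zero hb hper x, ← charFlow_zero hb hper z, this]

theorem continuous_slope_charFlow (hb : ContDiff ℝ 1 b) (hper : Function.Periodic b 1) {x z : ℝ}
    (hxz : x ≠ z) : Continuous fun s => slope b (charFlow b x s) (charFlow b z s) := by
  have hx := continuous_charFlow hb hper x
  have hz := continuous_charFlow hb hper z
  have := hb.continuous
  simp only [slope_def_field]
  exact Continuous.div (by fun_prop) (by fun_prop)
    fun s => sub_ne_zero.2 (charFlow_ne hb hper hxz.symm s)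

/-- The difference of two characteristics solves a linear equation whose coefficient is the
difference quotient of `b` between them; `E` carries the integrating factor. Monotonicity, two-sided
Lipschitz bounds and differentiability in `x` all follow from this formula. -/
theorem charFlow_sub_charFlow (hb : ContDiff ℝ 1 b) (hper : Function.Periodic b 1) {x z : ℝ}
    (hxz : x ≠ z) (t : ℝ) : charFlow b z t - charFlow b x t =
      (z - x) * Real.exp (∫ s in (0 : ℝ)..t, slope b (charFlow b x s) (charFlow b z s)) := by
  set q := fun s => slope b (charFlow b x s) (charFlow b z s) with hq
  have hqc : Continuous q := continuous_slope_charFlow hb hper hxz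
  set E := fun t => (charFlow b z t - charFlow b x t) * Real.exp (-∫ s in (0 : ℝ)..t, q s) with hE
  have hd : ∀ t, HasDerivAt E 0 t := fun t => by
    have h1 := (hasDerivAt_charFlow hb hper z t).sub (hasDerivAt_charFlow hb hper x t)
    have h2 := (hqc.integral_hasStrictDerivAt 0 t).hasDerivAt.neg.exp
    have h3 := h1.mul h2
    refine h3.congr_deriv ?_
    have h4 : q t * (charFlow b z t - charFlow b x t) =
        b (charFlow b z t) - b (charFlow b x t) := by
      rw [hq]
      simp only [slope_def_field]
      exact div_mul_cancel₀ _ (sub_ne_zero.2 (charFlow_ne hb hper hxz.symm t))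
    rw [← h4]
    simp only [Pi.sub_apply]
    ring
  have hc := is_const_of_deriv_eq_zero (fun t => (hd t).differentiableAt)
    (fun t => (hd t).deriv) t 0
  simp only [hE, intervalIntegral.integral_same, neg_zero, Real.exp_zero, mul_one,
    charFlow_zero hb hper] at hc
  rw [← hc, mul_assoc, ← Real.exp_add]
  simp

theorem abs_slope_le_of_lipschitzWith {L : NNReal} (hL : LipschitzWith L b) (x z : ℝ) :
    |slope b x z| ≤ L := by
  rw [slope_def_field, abs_div]
  refine div_le_of_le_mul₀ (abs_nonneg _) L.2 ?_
  simpa [Real.dist_eq] using hL.dist_le_mul z x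

theorem abs_integral_slope_charFlow_le {L : NNReal} (hL : LipschitzWith L b) (x z t : ℝ) :
    |∫ s in (0 : ℝ)..t, slope b (charFlow b x s) (charFlow b z s)| ≤ L * |t| := by
  simpa using intervalIntegral.norm_integral_le_of_norm_le_const (a := 0) (b := t)
    (f := fun s => slope b (charFlow b x s) (charFlow b z s)) (C := L)
    fun s _ => abs_slope_le_of_lipschitzWith hL _ _

theorem charFlow_sub_le (hb : ContDiff ℝ 1 b) (hper : Function.Periodic b 1) {L : NNReal}
    (hL : LipschitzWith L b) {x z : ℝ} (hxz : x ≤ z) (t : ℝ) :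
    charFlow b z t - charFlow b x t ≤ (z - x) * Real.exp (L * |t|) := by
  rcases hxz.eq_or_lt with rfl | h
  · simp
  rw [charFlow_sub_charFlow hb hper h.ne]
  exact mul_le_mul_of_nonneg_left (Real.exp_le_exp.2
    (abs_le.1 (abs_integral_slope_charFlow_le hL x z t)).2) (sub_nonneg.2 hxz)

theorem le_charFlow_sub (hb : ContDiff ℝ 1 b) (hper : Function.Periodic b 1) {L : NNReal}
    (hL : LipschitzWith L b) {x z : ℝ} (hxz : x ≤ z) (t : ℝ) :
    (z - x) * Real.exp (-(L * |t|)) ≤ charFlow b z t - charFlow b x t := by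
  rcases hxz.eq_or_lt with rfl | h
  · simp
  rw [charFlow_sub_charFlow hb hper h.ne]
  exact mul_le_mul_of_nonneg_left (Real.exp_le_exp.2
    (abs_le.1 (abs_integral_slope_charFlow_le hL x z t)).1) (sub_nonneg.2 hxz)

theorem strictMono_charFlow (hb : ContDiff ℝ 1 b) (hper : Function.Periodic b 1) (t : ℝ) :
    StrictMono fun x => charFlow b x t := fun x z h => by
  rw [← sub_pos, charFlow_sub_charFlow hb hper h.ne]
  exact mul_pos (sub_pos.2 h) (Real.exp_pos _)

theorem continuous_charFlow_left (hb : ContDiff ℝ 1 b) (hper : Function.Periodic b 1) (t : ℝ) :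
    Continuous fun x => charFlow b x t := by
  obtain ⟨L, hL⟩ := exists_lipschitz hb hper
  refine (LipschitzWith.of_dist_le_mul (K := (Real.exp (L * |t|)).toNNReal) ?_).continuous
  have key : ∀ x z, x ≤ z → dist (charFlow b x t) (charFlow b z t) ≤
      Real.exp (L * |t|) * dist x z := fun x z h => by
    rw [dist_comm, dist_comm x, Real.dist_eq, Real.dist_eq,
      abs_of_nonneg (sub_nonneg.2 ((strictMono_charFlow hb hper t).monotone h)),
      abs_of_nonneg (sub_nonneg.2 h), mul_comm]
    exact charFlow_sub_le hb hper hL h t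
  intro x z
  rw [Real.coe_toNNReal _ (Real.exp_pos _).le]
  rcases le_total x z with h | h
  · exact key x z h
  · rw [dist_comm, dist_comm x]
    exact key z x h

theorem continuous_uncurry_charFlow (hb : ContDiff ℝ 1 b) (hper : Function.Periodic b 1) :
    Continuous fun p : ℝ × ℝ => charFlow b p.2 p.1 := by
  obtain ⟨K, hK⟩ := exists_bound hb.continuous hper
  refine (continuous_prod_of_continuous_lipschitzWith' (fun p : ℝ × ℝ => charFlow b p.1 p.2) K
    (fun x => ?_) (fun t => continuous_charFlow_left hb hper t)).comp continuous_swap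
  exact lipschitzWith_of_nnnorm_deriv_le
    (fun t => (hasDerivAt_charFlow hb hper x t).differentiableAt) fun t => by
      rw [(hasDerivAt_charFlow hb hper x t).deriv]
      exact hK _

/-- The derivative of the flow map with respect to the initial point. -/
noncomputable def flowDeriv (b : ℝ → ℝ) (t x : ℝ) : ℝ :=
  Real.exp (∫ s in (0 : ℝ)..t, deriv b (charFlow b x s))

/-- Divide `charFlow_sub_charFlow` by `z - x` and let `z → x` by dominated convergence, the slopes
of `b` being bounded by `L`. -/
theorem hasDerivAt_charFlow_left (hb : ContDiff ℝ 1 b) (hper : Function.Periodic b 1)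
    (t x : ℝ) : HasDerivAt (fun x => charFlow b x t) (flowDeriv b t x) x := by
  obtain ⟨L, hL⟩ := exists_lipschitz hb hper
  rw [hasDerivAt_iff_tendsto_slope]
  have h1 : Filter.Tendsto
      (fun z => ∫ s in (0 : ℝ)..t, slope b (charFlow b x s) (charFlow b z s))
      (nhdsWithin x {x}ᶜ) (nhds (∫ s in (0 : ℝ)..t, deriv b (charFlow b x s))) := by
    refine intervalIntegral.tendsto_integral_filter_of_dominated_convergence (fun _ => (L : ℝ))
      ?_ ?_ (by simp) ?_
    · filter_upwards [self_mem_nhdsWithin] with z hz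
      exact (continuous_slope_charFlow hb hper (Ne.symm hz)).aestronglyMeasurable
    · exact Filter.Eventually.of_forall fun z => Filter.Eventually.of_forall fun s _ =>
        abs_slope_le_of_lipschitzWith hL _ _
    · refine Filter.Eventually.of_forall fun s _ => ?_
      have h2 := (hb.differentiable one_ne_zero (charFlow b x s)).hasDerivAt
      refine (hasDerivAt_iff_tendsto_slope.1 h2).comp ?_
      refine tendsto_nhdsWithin_iff.2 ⟨?_, ?_⟩
      · exact ((continuous_charFlow_left hb hper s).tendsto x).mono_left nhdsWithin_le_nhds
      · filter_upwards [self_mem_nhdsWithin] with z hz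
        exact charFlow_ne hb hper hz s
  refine ((Real.continuous_exp.tendsto _).comp h1).congr' ?_
  filter_upwards [self_mem_nhdsWithin] with z hz
  have hz' : z - x ≠ 0 := sub_ne_zero.2 hz
  rw [slope_def_field, charFlow_sub_charFlow hb hper (Ne.symm hz), mul_div_cancel_left₀ _ hz']
  rfl

/-- `v` is constant along the characteristic that reaches `x` at time `t`. The mean value theorem
needs differentiability only for interior times and continuity up to the ends. -/
theorem IsSolution.eq_comp_charFlow (hb : ContDiff ℝ 1 b) (hper : Function.Periodic b 1)
    {v₀ : ℝ → ℝ} {T : ℝ} {v : ℝ → ℝ → ℝ} (hv : IsSolution b v₀ T v) {t : ℝ}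
    (ht : t ∈ Set.Icc 0 T) (x : ℝ) : v t x = v₀ (charFlow b x (-t)) := by
  rcases ht.1.eq_or_lt with rfl | h0
  · rw [hv.initial, neg_zero, charFlow_zero hb hper]
  set y := fun s => charFlow b x (s - t) with hy
  have hyd : ∀ s, HasDerivAt y (b (y s)) s := fun s =>
    (hasDerivAt_charFlow hb hper x (s - t)).comp_sub_const s t
  have hyc : Continuous y := continuous_iff_continuousAt.2 fun s => (hyd s).continuousAt
  have hcont : ContinuousOn (fun s => v s (y s)) (Set.Icc 0 t) :=
    hv.continuousOn.comp (f := fun s => (s, y s)) (by fun_prop)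
      fun s hs => ⟨⟨hs.1, hs.2.trans ht.2⟩, trivial⟩
  have hder : ∀ s ∈ Set.Ioo 0 t, HasDerivAt (fun s => v s (y s)) 0 s := by
    intro s hs
    have hs' : s ∈ Set.Ioo 0 T := ⟨hs.1, hs.2.trans_le ht.2⟩
    have hD := (hv.differentiableAt s hs' (y s)).hasFDerivAt
    set D := fderiv ℝ (fun p : ℝ × ℝ => v p.1 p.2) (s, y s)
    have h1 : HasDerivAt (fun r => v r (y s)) (D (1, 0)) s :=
      hD.comp_hasDerivAt (f := fun r => (r, y s)) s
        ((hasDerivAt_id s).prodMk (hasDerivAt_const s (y s)))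
    have h2 : HasDerivAt (fun z => v s z) (D (0, 1)) (y s) :=
      hD.comp_hasDerivAt (f := fun z => (s, z)) (y s)
        ((hasDerivAt_const (y s) s).prodMk (hasDerivAt_id (y s)))
    have h3 : HasDerivAt (fun r => v r (y r)) (D (1, b (y s))) s :=
      hD.comp_hasDerivAt (f := fun r => (r, y r)) s ((hasDerivAt_id s).prodMk (hyd s))
    have h4 := hv.equation s hs' (y s)
    rw [h1.deriv, h2.deriv] at h4
    convert h3 using 1
    rw [← h4, ← smul_eq_mul, ← map_smul, ← map_add]
    simp
  obtain ⟨s, _, hs⟩ := exists_hasDerivAt_eq_slope _ _ h0 hcont hder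
  rw [eq_comm, div_eq_zero_iff, sub_eq_zero] at hs
  rcases hs with hs | hs
  · simp only [hy, sub_self, zero_sub, charFlow_zero hb hper] at hs
    rw [hs, hv.initial]
  · exact absurd hs (by linarith)

end Flow

/-! ### Exponential bounds for `x`-derivatives along the flow, and local polynomial approximation.
-/

section Regularity

/-- `f` is jointly continuous and grows at most like `exp (c|t|)` in its first argument. -/
def ExpBounded (c : ℝ) (f : ℝ → ℝ → ℝ) : Prop :=
  (Continuous fun p : ℝ × ℝ => f p.1 p.2) ∧ ∃ C : ℝ, ∀ t x, |f t x| ≤ C * Real.exp (c * |t|)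

/-- `f` has `m` derivatives with respect to its second argument, all of which are `ExpBounded`. -/
def ExpRegular (c : ℝ) : ℕ → (ℝ → ℝ → ℝ) → Prop
  | 0, f => ExpBounded c f
  | m + 1, f => ExpBounded c f ∧
      ∃ f' : ℝ → ℝ → ℝ, (∀ t x, HasDerivAt (f t) (f' t x) x) ∧ ExpRegular c m f'

variable {c d : ℝ} {f g : ℝ → ℝ → ℝ}

theorem ExpBounded.exists_nonneg (hf : ExpBounded c f) :
    ∃ C : ℝ, 0 ≤ C ∧ ∀ t x, |f t x| ≤ C * Real.exp (c * |t|) := by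
  obtain ⟨-, C, hC⟩ := hf
  refine ⟨C, ?_, hC⟩
  simpa using (abs_nonneg _).trans (hC 0 0)

theorem ExpBounded.mono (hf : ExpBounded c f) (h : c ≤ d) : ExpBounded d f := by
  obtain ⟨C, h0, hC⟩ := hf.exists_nonneg
  exact ⟨hf.1, C, fun t x => (hC t x).trans (by gcongr)⟩

theorem ExpBounded.add (hf : ExpBounded c f) (hg : ExpBounded c g) :
    ExpBounded c fun t x => f t x + g t x := by
  obtain ⟨hf, C, hC⟩ := hf
  obtain ⟨hg, D, hD⟩ := hg
  refine ⟨hf.add hg, C + D, fun t x => (abs_add_le _ _).trans ?_⟩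
  rw [add_mul]
  exact add_le_add (hC t x) (hD t x)

theorem ExpBounded.mul (hf : ExpBounded c f) (hg : ExpBounded d g) :
    ExpBounded (c + d) fun t x => f t x * g t x := by
  obtain ⟨C, h0, hC⟩ := hf.exists_nonneg
  obtain ⟨D, -, hD⟩ := hg.exists_nonneg
  refine ⟨hf.1.mul hg.1, C * D, fun t x => ?_⟩
  rw [abs_mul, add_mul, Real.exp_add, mul_mul_mul_comm]
  exact mul_le_mul (hC t x) (hD t x) (abs_nonneg _) (by positivity)

theorem ExpRegular.expBounded {m : ℕ} (hf : ExpRegular c m f) : ExpBounded c f := by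
  cases m with
  | zero => exact hf
  | succ m => exact hf.1

theorem ExpRegular.of_succ {m : ℕ} (hf : ExpRegular c (m + 1) f) : ExpRegular c m f := by
  induction m generalizing f with
  | zero => exact hf.1
  | succ m ih =>
    obtain ⟨hf, f', hd, hf'⟩ := hf
    exact ⟨hf, f', hd, ih hf'⟩

theorem ExpRegular.mono {m : ℕ} (hf : ExpRegular c m f) (h : c ≤ d) : ExpRegular d m f := by
  induction m generalizing f with
  | zero => exact ExpBounded.mono hf h
  | succ m ih =>
    obtain ⟨hf, f', hd, hf'⟩ := hf
    exact ⟨hf.mono h, f', hd, ih hf'⟩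

theorem ExpRegular.add {m : ℕ} (hf : ExpRegular c m f) (hg : ExpRegular c m g) :
    ExpRegular c m fun t x => f t x + g t x := by
  induction m generalizing f g with
  | zero => exact ExpBounded.add hf hg
  | succ m ih =>
    obtain ⟨hf, f', hfd, hf'⟩ := hf
    obtain ⟨hg, g', hgd, hg'⟩ := hg
    exact ⟨hf.add hg, _, fun t x => (hfd t x).add (hgd t x), ih hf' hg'⟩

theorem ExpRegular.mul {m : ℕ} (hf : ExpRegular c m f) (hg : ExpRegular d m g) :
    ExpRegular (c + d) m fun t x => f t x * g t x := by
  induction m generalizing f g with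
  | zero => exact ExpBounded.mul hf hg
  | succ m ih =>
    have hfm := hf.of_succ
    have hgm := hg.of_succ
    obtain ⟨hf, f', hfd, hf'⟩ := hf
    obtain ⟨hg, g', hgd, hg'⟩ := hg
    exact ⟨hf.mul hg, _, fun t x => (hfd t x).mul (hgd t x), (ih hf' hgm).add (ih hfm hg')⟩

/-- The factor `|t|` from integration is absorbed by `e^{|t|}`, which raises the rate by one. -/
theorem ExpBounded.abs_integral_le (hc : 0 ≤ c) {C : ℝ} (hC0 : 0 ≤ C)
    (hC : ∀ t x, |f t x| ≤ C * Real.exp (c * |t|)) (t x : ℝ) :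
    |∫ s in (0 : ℝ)..t, f s x| ≤ C * Real.exp ((c + 1) * |t|) := by
  have h1 : |∫ s in (0 : ℝ)..t, f s x| ≤ C * Real.exp (c * |t|) * |t - 0| := by
    refine intervalIntegral.norm_integral_le_of_norm_le_const (f := fun s => f s x)
      fun s hs => (hC s x).trans ?_
    have hst : |s| ≤ |t| := by
      simpa using Set.abs_sub_left_of_mem_uIcc (Set.uIoc_subset_uIcc hs)
    gcongr
  refine h1.trans ?_
  rw [sub_zero, add_mul, Real.exp_add, one_mul, mul_assoc]
  gcongr
  exact (le_add_of_nonneg_right zero_le_one).trans (Real.add_one_le_exp |t|)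

theorem ExpBounded.integral (hc : 0 ≤ c) (hf : ExpBounded c f) :
    ExpBounded (c + 1) fun t x => ∫ s in (0 : ℝ)..t, f s x := by
  obtain ⟨C, h0, hC⟩ := hf.exists_nonneg
  refine ⟨?_, C, ExpBounded.abs_integral_le hc h0 hC⟩
  have h := hf.1
  exact intervalIntegral.continuous_parametric_intervalIntegral_of_continuous
    (f := fun (p : ℝ × ℝ) s => f s p.2) (s := fun p => p.1)
    (h.comp (f := fun q : (ℝ × ℝ) × ℝ => (q.2, q.1.2)) (by fun_prop)) continuous_fst

theorem ExpRegular.integral {m : ℕ} (hc : 0 ≤ c) (hf : ExpRegular c m f) :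
    ExpRegular (c + 1) m fun t x => ∫ s in (0 : ℝ)..t, f s x := by
  induction m generalizing f with
  | zero => exact ExpBounded.integral hc hf
  | succ m ih =>
    obtain ⟨hf, f', hd, hf'⟩ := hf
    refine ⟨hf.integral hc, _, fun t x => ?_, ih hf'⟩
    have hcf := fun x => hf.1.comp (f := fun s : ℝ => (s, x)) (by fun_prop)
    have hcf' := fun x => hf'.expBounded.1.comp (f := fun s : ℝ => (s, x)) (by fun_prop)
    obtain ⟨C, -, hC⟩ := hf'.expBounded.exists_nonneg
    exact (intervalIntegral.hasDerivAt_integral_of_dominated_loc_of_deriv_le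
      (F := fun x s => f s x) (F' := fun x s => f' s x) (s := Set.univ)
      (bound := fun s => C * Real.exp (c * |s|)) Filter.univ_mem
      (Filter.Eventually.of_forall fun x => (hcf x).aestronglyMeasurable)
      ((hcf x).intervalIntegrable _ _) (hcf' x).aestronglyMeasurable
      (Filter.Eventually.of_forall fun s _ x _ => hC s x)
      (Continuous.intervalIntegrable (by fun_prop) _ _)
      (Filter.Eventually.of_forall fun s _ x _ => hd s x)).2

variable {b : ℝ → ℝ}

theorem periodic_deriv {g : ℝ → ℝ} (hg : Function.Periodic g 1) :
    Function.Periodic (deriv g) 1 := fun z => by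
  have h : (fun x => g (x + 1)) = g := funext hg
  rw [← deriv_comp_add_const, h]

theorem expBounded_comp_charFlow (hb : ContDiff ℝ 1 b) (hper : Function.Periodic b 1)
    {g : ℝ → ℝ} (hg : Continuous g) (hgper : Function.Periodic g 1) :
    ExpBounded 0 fun t x => g (charFlow b x t) := by
  obtain ⟨K, hK⟩ := exists_bound hg hgper
  exact ⟨hg.comp (continuous_uncurry_charFlow hb hper), K, fun t x => by simpa using hK _⟩

/-- Chain rule: the derivative is `(g' ∘ flow) * flowDeriv`; `g'` falls under the hypothesis one
order lower, and rates add in products. -/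
theorem ExpRegular.comp_charFlow_succ (hb : ContDiff ℝ 1 b) (hper : Function.Periodic b 1)
    {m : ℕ} (hc : 0 ≤ c) (hd : 0 ≤ d) (hψ : ExpRegular c m (flowDeriv b))
    (H : ∀ g : ℝ → ℝ, ContDiff ℝ (m : WithTop ℕ∞) g → Function.Periodic g 1 →
      ExpRegular d m fun t x => g (charFlow b x t))
    {g : ℝ → ℝ} (hg : ContDiff ℝ ((m + 1 : ℕ) : WithTop ℕ∞) g) (hgper : Function.Periodic g 1) :
    ExpRegular (d + c) (m + 1) fun t x => g (charFlow b x t) := by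
  have hg' : ContDiff ℝ (m + 1 : WithTop ℕ∞) g := by exact_mod_cast hg
  refine ⟨(expBounded_comp_charFlow hb hper hg.continuous hgper).mono (by positivity),
    fun t x => deriv g (charFlow b x t) * flowDeriv b t x, fun t x => ?_,
    (H _ hg'.deriv' (periodic_deriv hgper)).mul hψ⟩
  exact ((hg.differentiable (by simp) _).hasDerivAt.comp x
    (hasDerivAt_charFlow_left hb hper t x))

/-- The rate `d` is chosen before `g`; this makes the final `C₁` independent of `v₀`. -/
theorem exists_expRegular_comp_charFlow (hb : ContDiff ℝ 1 b) (hper : Function.Periodic b 1)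
    {m : ℕ} (hc : 0 ≤ c) (hψ : ExpRegular c m (flowDeriv b)) :
    ∃ d, 0 ≤ d ∧ ∀ g : ℝ → ℝ, ContDiff ℝ ((m + 1 : ℕ) : WithTop ℕ∞) g →
      Function.Periodic g 1 → ExpRegular d (m + 1) fun t x => g (charFlow b x t) := by
  induction m with
  | zero =>
    exact ⟨0 + c, by positivity, fun g hg hgper => ExpRegular.comp_charFlow_succ hb hper hc le_rfl
      hψ (fun g hg hgper => expBounded_comp_charFlow hb hper hg.continuous hgper) hg hgper⟩
  | succ m ih =>
    obtain ⟨d, hd, H⟩ := ih hψ.of_succ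
    exact ⟨d + c, by positivity, fun g hg hgper =>
      ExpRegular.comp_charFlow_succ hb hper hc hd hψ H hg hgper⟩

/-- A bootstrap: `m` derivatives of `flowDeriv` give `m + 1` of `b' ∘ flow`, hence of its time
integral `I`. As `flowDeriv = exp I`, its derivative `flowDeriv * I'` has `m` derivatives, so
`flowDeriv` has `m + 1`. -/
theorem exists_expRegular_flowDeriv {m : ℕ} (hb : ContDiff ℝ ((m + 1 : ℕ) : WithTop ℕ∞) b)
    (hper : Function.Periodic b 1) : ∃ c, 0 ≤ c ∧ ExpRegular c m (flowDeriv b) := by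
  have hb1 : ContDiff ℝ 1 b := hb.of_le (by exact_mod_cast (by simp : 1 ≤ m + 1))
  have hbc : Continuous (deriv b) := hb1.continuous_deriv le_rfl
  obtain ⟨L, hL⟩ := exists_bound hbc (periodic_deriv hper)
  have h0 : ExpBounded L (flowDeriv b) := by
    refine ⟨Real.continuous_exp.comp
      ((expBounded_comp_charFlow hb1 hper hbc (periodic_deriv hper)).integral le_rfl).1,
      1, fun t x => ?_⟩
    rw [one_mul, flowDeriv, Real.abs_exp, Real.exp_le_exp]
    refine (le_abs_self _).trans ?_
    simpa using intervalIntegral.norm_integral_le_of_norm_le_const (a := 0) (b := t)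
      (f := fun s => deriv b (charFlow b x s)) (C := L) fun s _ => hL _
  induction m with
  | zero => exact ⟨L, L.2, h0⟩
  | succ m ih =>
    have hbm : ContDiff ℝ ((m + 1 : ℕ) : WithTop ℕ∞) b := hb.of_le (by norm_cast; simp)
    obtain ⟨c, hc, hψ⟩ := ih hbm
    obtain ⟨d, hd, H⟩ := exists_expRegular_comp_charFlow hb1 hper hc hψ
    have hb' : ContDiff ℝ (((m + 1 : ℕ) : WithTop ℕ∞) + 1) b := by exact_mod_cast hb
    obtain ⟨-, I', hI, hI'⟩ := (H _ hb'.deriv' (periodic_deriv hper)).integral hd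
    refine ⟨L + (c + (d + 1)), by positivity, h0.mono (by linarith), _,
      fun t x => (hI t x).exp, ?_⟩
    exact (hψ.mul hI').mono (by linarith [L.2])

theorem exists_antiderivative (q : Polynomial ℝ) {m : ℕ} (hq : q.degree < m) :
    ∃ P : Polynomial ℝ, P.degree < (m + 1 : ℕ) ∧ P.derivative = q := by
  rcases eq_or_ne q 0 with rfl | hq0
  · exact ⟨0, by simp, by simp⟩
  refine ⟨∑ i ∈ Finset.range m, Polynomial.monomial (i + 1) (q.coeff i / (i + 1)), ?_, ?_⟩
  · refine (Polynomial.degree_sum_le _ _).trans_lt ?_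
    rw [Finset.sup_lt_iff (WithBot.bot_lt_coe _)]
    intro i hi
    refine (Polynomial.degree_monomial_le _ _).trans_lt ?_
    exact_mod_cast Nat.succ_lt_succ (Finset.mem_range.1 hi)
  · rw [Polynomial.derivative_sum]
    conv_rhs => rw [q.as_sum_range' m ((Polynomial.natDegree_lt_iff_degree_lt hq0).2 hq)]
    refine Finset.sum_congr rfl fun i _ => ?_
    rw [Polynomial.derivative_monomial]
    congr 1
    push_cast
    field_simp

/-- Integrate an approximant of the derivative, matching `f` at `a`; the mean value inequality then
gains one factor `h`. At order `0` the strict degree bound leaves only `p = 0`. -/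
theorem ExpRegular.exists_polynomial_approx {m : ℕ} (hf : ExpRegular c m f) :
    ∃ C : ℝ, 0 ≤ C ∧ ∀ t a h : ℝ, 0 ≤ h → ∃ p : Polynomial ℝ, p.degree < m ∧
      ∀ x ∈ Set.Icc a (a + h), |f t x - p.eval x| ≤ C * Real.exp (c * |t|) * h ^ m := by
  induction m generalizing f with
  | zero =>
    obtain ⟨C, h0, hC⟩ := hf.expBounded.exists_nonneg
    exact ⟨C, h0, fun t a h _ => ⟨0, by simp, fun x _ => by simpa using hC t x⟩⟩
  | succ m ih =>
    obtain ⟨-, f', hd, hf'⟩ := hf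
    obtain ⟨C, h0, hC⟩ := ih hf'
    refine ⟨C, h0, fun t a h hh => ?_⟩
    obtain ⟨q, hq, hfq⟩ := hC t a h hh
    obtain ⟨P, hP, rfl⟩ := exists_antiderivative q hq
    refine ⟨P + Polynomial.C (f t a - P.eval a), ?_, fun x hx => ?_⟩
    · refine (Polynomial.degree_add_le _ _).trans_lt (max_lt hP ?_)
      exact Polynomial.degree_C_le.trans_lt (by exact_mod_cast Nat.succ_pos m)
    · have h1 := (convex_Icc a (a + h)).norm_image_sub_le_of_norm_hasDerivWithin_le
        (f := fun x => f t x - P.eval x) (C := C * Real.exp (c * |t|) * h ^ m)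
        (fun x _ => ((hd t x).sub (P.hasDerivAt x)).hasDerivWithinAt) (fun x hx => hfq x hx)
        (Set.left_mem_Icc.2 (by linarith)) hx
      have h2 : ‖x - a‖ ≤ h := by
        rw [Real.norm_eq_abs, abs_of_nonneg (by linarith [hx.1])]
        linarith [hx.2]
      rw [Polynomial.eval_add, Polynomial.eval_C, pow_succ, ← mul_assoc]
      refine le_trans (le_of_eq ?_) (h1.trans (by gcongr))
      rw [Real.norm_eq_abs]
      congr 1
      ring

end Regularity

/-! ### Gauss quadrature and its stability under displacement of the nodes. -/

section Gauss

variable {k : ℕ} {ξ ω : Fin (k + 1) → ℝ}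

/-- The composition of a polynomial with the affine map `x ↦ r * x + s`. -/
theorem exists_polynomial_comp_affine (p : Polynomial ℝ) (r s : ℝ) :
    ∃ q : Polynomial ℝ, q.natDegree ≤ p.natDegree ∧ ∀ x, q.eval x = p.eval (r * x + s) := by
  refine ⟨p.comp (Polynomial.C r * Polynomial.X + Polynomial.C s), ?_, fun x => by simp⟩
  refine Polynomial.natDegree_comp_le.trans ?_
  exact (Nat.mul_le_mul_left _ Polynomial.natDegree_linear_le).trans (mul_one _).le

theorem IsGaussRule.gaussSum_eq_integral (hG : IsGaussRule k ξ ω) (p : Polynomial ℝ)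
    (hp : p.natDegree ≤ 2 * k + 1) (a c : ℝ) :
    gaussSum ξ ω a c (fun x => p.eval x) = ∫ x in a..c, p.eval x := by
  obtain ⟨q, hq, hqe⟩ := exists_polynomial_comp_affine p ((c - a) / 2) ((a + c) / 2)
  have h1 := hG.exact q (hq.trans hp)
  have h2 := intervalIntegral.smul_integral_comp_mul_add (a := -1) (b := 1)
    (fun x => p.eval x) ((c - a) / 2) ((a + c) / 2)
  have e1 : (c - a) / 2 * (-1) + (a + c) / 2 = a := by ring
  have e2 : (c - a) / 2 * 1 + (a + c) / 2 = c := by ring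
  rw [e1, e2] at h2
  rw [← h2, ← intervalIntegral.integral_congr fun x _ => hqe x, h1, smul_eq_mul, gaussSum,
    Finset.mul_sum]
  refine Finset.sum_congr rfl fun α _ => ?_
  rw [hqe]
  ring_nf

theorem IsGaussRule.sum_weight (hG : IsGaussRule k ξ ω) : ∑ α, ω α = 2 := by
  have h := hG.exact 1 (by simp)
  norm_num at h
  exact h.symm

theorem IsGaussRule.sum_weight_mul_sq (hG : IsGaussRule k ξ ω) {p : Polynomial ℝ}
    (hp : p.natDegree ≤ k) :
    ∑ α, ω α * p.eval (ξ α) ^ 2 = ∫ x in (-1 : ℝ)..1, p.eval x ^ 2 := by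
  have h := hG.exact (p ^ 2) (Polynomial.natDegree_pow_le.trans (by omega))
  simpa using h.symm

theorem exists_lipschitz_polynomial (p : Polynomial ℝ) :
    ∃ K : ℝ, 0 ≤ K ∧ ∀ x ∈ Set.Icc (-1 : ℝ) 1, ∀ y ∈ Set.Icc (-1 : ℝ) 1,
      |p.eval x - p.eval y| ≤ K * |x - y| := by
  obtain ⟨K, hK⟩ := isCompact_Icc.exists_bound_of_continuousOn (s := Set.Icc (-1 : ℝ) 1)
    p.derivative.continuous.continuousOn
  refine ⟨K, (norm_nonneg _).trans (hK 0 (by simp)), fun x hx y hy => ?_⟩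
  exact (convex_Icc (-1 : ℝ) 1).norm_image_sub_le_of_norm_hasDerivWithin_le
    (fun x _ => (p.hasDerivAt x).hasDerivWithinAt) hK hy hx

/-- Expand `p²` in products of Lagrange basis polynomials at the Gauss nodes. Positive weights and
exactness on `p²` bound each `p(ξ α)²` by `(ω α)⁻¹ ∫ p²`; the products of basis functions are fixed
Lipschitz functions. -/
theorem IsGaussRule.exists_abs_sq_sub_sq_le (hG : IsGaussRule k ξ ω) :
    ∃ Λ : ℝ, 0 ≤ Λ ∧ ∀ p : Polynomial ℝ, p.natDegree ≤ k →
      ∀ x ∈ Set.Icc (-1 : ℝ) 1, ∀ y ∈ Set.Icc (-1 : ℝ) 1,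
      |p.eval x ^ 2 - p.eval y ^ 2| ≤ Λ * |x - y| * ∫ z in (-1 : ℝ)..1, p.eval z ^ 2 := by
  set l := Lagrange.basis Finset.univ ξ with hl
  choose K hK0 hK using fun α β => exists_lipschitz_polynomial (l α * l β)
  have hω := fun α => inv_nonneg.2 (hG.weight_pos α).le
  refine ⟨∑ α, ∑ β, ((ω α)⁻¹ + (ω β)⁻¹) * K α β, ?_, fun p hp x hx y hy => ?_⟩
  · exact Finset.sum_nonneg fun α _ => Finset.sum_nonneg fun β _ =>
      mul_nonneg (add_nonneg (hω α) (hω β)) (hK0 α β)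
  set I := ∫ z in (-1 : ℝ)..1, p.eval z ^ 2 with hI
  have hval : ∀ α, p.eval (ξ α) ^ 2 ≤ (ω α)⁻¹ * I := fun α => by
    rw [inv_mul_eq_div, le_div_iff₀' (hG.weight_pos α), hI, ← hG.sum_weight_mul_sq hp]
    exact Finset.single_le_sum (f := fun α => ω α * p.eval (ξ α) ^ 2)
      (fun β _ => mul_nonneg (hG.weight_pos β).le (sq_nonneg _)) (Finset.mem_univ α)
  have hint : ∀ z, p.eval z ^ 2 =
      ∑ α, ∑ β, p.eval (ξ α) * p.eval (ξ β) * (l α * l β).eval z := fun z => by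
    have h1 : p = Lagrange.interpolate Finset.univ ξ fun α => p.eval (ξ α) :=
      Lagrange.eq_interpolate hG.node_injective.injOn (by
        refine Polynomial.degree_le_natDegree.trans_lt ?_
        rw [Finset.card_univ, Fintype.card_fin]
        exact_mod_cast Nat.lt_succ_of_le hp)
    have h2 : p.eval z = ∑ α, p.eval (ξ α) * (l α).eval z := by
      conv_lhs => rw [h1, Lagrange.interpolate_apply, Polynomial.eval_finsetSum]
      simp [hl]
    rw [h2, sq, Finset.sum_mul_sum]
    refine Finset.sum_congr rfl fun α _ => Finset.sum_congr rfl fun β _ => ?_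
    rw [Polynomial.eval_mul]
    ring
  rw [hint x, hint y, ← Finset.sum_sub_distrib, Finset.sum_mul, Finset.sum_mul]
  refine (Finset.abs_sum_le_sum_abs _ _).trans (Finset.sum_le_sum fun α _ => ?_)
  rw [← Finset.sum_sub_distrib, Finset.sum_mul, Finset.sum_mul]
  refine (Finset.abs_sum_le_sum_abs _ _).trans (Finset.sum_le_sum fun β _ => ?_)
  rw [← mul_sub, abs_mul]
  have h3 : |p.eval (ξ α) * p.eval (ξ β)| ≤ ((ω α)⁻¹ + (ω β)⁻¹) * I := by
    have h4 := hval α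
    have h5 := hval β
    rw [add_mul, abs_le]
    constructor <;> nlinarith [sq_nonneg (p.eval (ξ α) + p.eval (ξ β)),
      sq_nonneg (p.eval (ξ α) - p.eval (ξ β))]
  calc _ ≤ ((ω α)⁻¹ + (ω β)⁻¹) * I * (K α β * |x - y|) :=
        mul_le_mul h3 (hK α β x hx y hy) (abs_nonneg _) ((abs_nonneg _).trans h3)
    _ = _ := by ring

/-- Stability of the Gauss rule when its nodes are moved by a fraction of the interval. -/
theorem IsGaussRule.exists_sum_sq_le (hG : IsGaussRule k ξ ω) :
    ∃ Λ : ℝ, 0 ≤ Λ ∧ ∀ p : Polynomial ℝ, p.natDegree ≤ k → ∀ A B : ℝ, A < B →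
      ∀ (z : Fin (k + 1) → ℝ) (η : ℝ), (∀ α, z α ∈ Set.Icc A B) →
      (∀ α, |z α - (A + (1 + ξ α) / 2 * (B - A))| ≤ η * (B - A)) →
      ∑ α, ω α / 2 * (B - A) * p.eval (z α) ^ 2 ≤ (1 + Λ * η) * ∫ x in A..B, p.eval x ^ 2 := by
  obtain ⟨Λ, hΛ, H⟩ := hG.exists_abs_sq_sub_sq_le
  -- One factor 2 comes from rescaling the displacement to `(-1,1)`, the other from the total weight
  -- 2.
  refine ⟨4 * Λ, by positivity, fun p hp A B hAB z η hz hη => ?_⟩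
  have hBA : 0 < B - A := sub_pos.2 hAB
  obtain ⟨q, hq, hqe⟩ := exists_polynomial_comp_affine p ((B - A) / 2) ((A + B) / 2)
  have hI := intervalIntegral.smul_integral_comp_mul_add (a := -1) (b := 1)
    (fun x => p.eval x ^ 2) ((B - A) / 2) ((A + B) / 2)
  have e1 : (B - A) / 2 * (-1) + (A + B) / 2 = A := by ring
  have e2 : (B - A) / 2 * 1 + (A + B) / 2 = B := by ring
  rw [e1, e2, smul_eq_mul, intervalIntegral.integral_congr fun x _ =>
    congrArg (· ^ 2) (hqe x).symm] at hI
  set J := ∫ x in (-1 : ℝ)..1, q.eval x ^ 2 with hJ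
  have hJ0 : 0 ≤ J := intervalIntegral.integral_nonneg (by norm_num) fun x _ => sq_nonneg _
  set s := fun α => 2 * (z α - A) / (B - A) - 1 with hs
  have hs1 : ∀ α, q.eval (s α) = p.eval (z α) := fun α => by
    rw [hqe, hs]
    congr 1
    field_simp
    ring
  have hs2 : ∀ α, s α ∈ Set.Icc (-1 : ℝ) 1 := fun α => by
    have h1 := (hz α).1
    have h2 := (hz α).2
    have h3 : 0 ≤ 2 * (z α - A) / (B - A) := div_nonneg (by linarith) hBA.le
    have h4 : 2 * (z α - A) / (B - A) ≤ 2 := by rw [div_le_iff₀ hBA]; linarith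
    constructor <;> simp only [hs] <;> linarith
  have hs3 : ∀ α, |s α - ξ α| ≤ 2 * η := fun α => by
    have h1 : s α - ξ α = 2 * (z α - (A + (1 + ξ α) / 2 * (B - A))) / (B - A) := by
      simp only [hs]
      field_simp
      ring
    rw [h1, abs_div, abs_mul, abs_of_pos hBA, div_le_iff₀ hBA, abs_two]
    linarith [hη α]
  have hterm : ∀ α, ω α * q.eval (s α) ^ 2 ≤
      ω α * q.eval (ξ α) ^ 2 + ω α * (Λ * (2 * η) * J) := fun α => by
    rw [← mul_add]
    refine mul_le_mul_of_nonneg_left ?_ (hG.weight_pos α).le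
    have h1 := H q (hq.trans hp) (s α) (hs2 α) (ξ α) (Set.Ioo_subset_Icc_self (hG.node_mem α))
    have h2 : Λ * |s α - ξ α| * J ≤ Λ * (2 * η) * J := by
      gcongr
      exact hs3 α
    linarith [(abs_le.1 h1).2]
  have hsum := Finset.sum_le_sum fun α (_ : α ∈ Finset.univ) => hterm α
  rw [Finset.sum_add_distrib, ← Finset.sum_mul, hG.sum_weight,
    hG.sum_weight_mul_sq (hq.trans hp), ← hJ] at hsum
  calc ∑ α, ω α / 2 * (B - A) * p.eval (z α) ^ 2
      = (B - A) / 2 * ∑ α, ω α * q.eval (s α) ^ 2 := by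
        rw [Finset.mul_sum]
        refine Finset.sum_congr rfl fun α _ => ?_
        rw [hs1]
        ring
    _ ≤ (B - A) / 2 * (J + 2 * (Λ * (2 * η) * J)) := by gcongr
    _ = (1 + 4 * Λ * η) * ((B - A) / 2 * J) := by ring
    _ = _ := by rw [hI]

/-- Puts the factor `1 + Λη`, with `η = e^s - 1`, in a form that multiplies over time steps. -/
theorem one_add_mul_exp_sub_one_le {r s : ℝ} (hr : 0 ≤ r) (hs : 0 ≤ s) :
    1 + r * (Real.exp s - 1) ≤ Real.exp s * Real.exp (r * s) := by
  have h1 := Real.add_one_le_exp (r * s)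
  have h2 := Real.add_one_le_exp (-s)
  have h3 : Real.exp s * Real.exp (-s) = 1 := by rw [← Real.exp_add]; simp
  have h4 : 0 < Real.exp s := Real.exp_pos s
  have h5 : 1 ≤ Real.exp s := Real.one_le_exp hs
  have h6 := mul_le_mul_of_nonneg_left h1 h4.le
  have h7 := mul_le_mul_of_nonneg_left (mul_le_mul_of_nonneg_left h2 h4.le) hr
  rw [h3] at h7
  linarith

end Gauss

/-! ### Stability on one sub-interval. -/

section LocalStability

variable {k : ℕ} {ξ ω : Fin (k + 1) → ℝ} {b : ℝ → ℝ}

theorem IsGaussRule.add_mul_mem (hG : IsGaussRule k ξ ω) {a c : ℝ} (hac : a < c)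
    (α : Fin (k + 1)) : a + (1 + ξ α) / 2 * (c - a) ∈ Set.Ioo a c := by
  have h1 := (hG.node_mem α).1
  have h2 := (hG.node_mem α).2
  constructor <;> nlinarith

/-- Both the sub-length and the whole length are distorted by factors between `e^{-L|t|}` and
`e^{L|t|}`, so their ratio changes by at most `e^{±2L|t|}`. The relative bound does not depend on `c
- a`. -/
theorem abs_charFlow_sub_affine_le (hb : ContDiff ℝ 1 b) (hper : Function.Periodic b 1)
    {L : NNReal} (hL : LipschitzWith L b) {a c θ : ℝ} (hac : a ≤ c) (hθ0 : 0 ≤ θ) (hθ1 : θ ≤ 1)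
    (t : ℝ) :
    |charFlow b (a + θ * (c - a)) t -
      (charFlow b a t + θ * (charFlow b c t - charFlow b a t))| ≤
      (Real.exp (2 * (L * |t|)) - 1) * (charFlow b c t - charFlow b a t) := by
  have hac' := sub_nonneg.2 hac
  have haz : a ≤ a + θ * (c - a) := le_add_of_nonneg_right (by positivity)
  have u1 := charFlow_sub_le hb hper hL haz t
  have l1 := le_charFlow_sub hb hper hL haz t
  have u2 := charFlow_sub_le hb hper hL hac t
  have l2 := le_charFlow_sub hb hper hL hac t
  rw [add_sub_cancel_left] at u1 l1
  set z := charFlow b (a + θ * (c - a)) t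
  set A := charFlow b a t
  set B := charFlow b c t
  set E := Real.exp (L * |t|) with hE
  have hE2 : Real.exp (2 * (L * |t|)) = E * E := by rw [hE, ← Real.exp_add]; ring_nf
  have hE1 : 1 ≤ E := Real.one_le_exp (by positivity)
  have hEi : Real.exp (-(L * |t|)) * E = 1 := by rw [hE, ← Real.exp_add]; simp
  set F := Real.exp (-(L * |t|))
  have hF0 : 0 < F := Real.exp_pos _
  have hBA : 0 ≤ B - A := le_trans (by positivity) l2
  rw [hE2]
  have h1 : c - a ≤ E * (B - A) := by
    have := mul_le_mul_of_nonneg_left l2 (zero_le_one.trans hE1)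
    calc c - a = (c - a) * (F * E) := by rw [hEi, mul_one]
      _ = E * ((c - a) * F) := by ring
      _ ≤ _ := this
  have h2 : F * (B - A) ≤ c - a := by
    have := mul_le_mul_of_nonneg_left u2 hF0.le
    calc F * (B - A) ≤ F * ((c - a) * E) := this
      _ = (c - a) * (F * E) := by ring
      _ = c - a := by rw [hEi, mul_one]
  have h3 : z - A ≤ θ * (E * E * (B - A)) := by
    calc z - A ≤ θ * (c - a) * E := u1
      _ ≤ θ * (E * (B - A)) * E := by gcongr
      _ = _ := by ring
  have h4 : θ * (F * F * (B - A)) ≤ z - A := by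
    calc θ * (F * F * (B - A)) = θ * (F * (B - A)) * F := by ring
      _ ≤ θ * (c - a) * F := by gcongr
      _ ≤ _ := l1
  have hEE : 1 ≤ E * E := one_le_mul_of_one_le_of_one_le hE1 hE1
  -- Since `E F = 1`, this is `E² + F² ≥ 2`; the lower deviation is thus covered by the upper one.
  have hFF : 1 - F * F ≤ E * E - 1 := by
    have : (F * F) * (E * E) = 1 := by rw [mul_mul_mul_comm, hEi, one_mul]
    nlinarith [sq_nonneg (E - F)]
  have h5 : θ * ((E * E - 1) * (B - A)) ≤ (E * E - 1) * (B - A) :=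
    mul_le_of_le_one_left (mul_nonneg (by linarith) hBA) hθ1
  have h6 : θ * ((1 - F * F) * (B - A)) ≤ θ * ((E * E - 1) * (B - A)) := by gcongr
  rw [abs_le]
  constructor <;> linarith

/-- Stability of one step on an interval that the flow maps into one cell of the mesh. -/
theorem IsGaussRule.exists_gaussSum_charFlow_le (hG : IsGaussRule k ξ ω) (hb : ContDiff ℝ 1 b)
    (hper : Function.Periodic b 1) :
    ∃ c₁ : ℝ, 0 ≤ c₁ ∧ ∀ p : Polynomial ℝ, p.natDegree ≤ k → ∀ a c t : ℝ, a < c →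
      gaussSum ξ ω a c (fun x => p.eval (charFlow b x t) ^ 2) ≤
        Real.exp (c₁ * |t|) * ∫ x in charFlow b a t..charFlow b c t, p.eval x ^ 2 := by
  obtain ⟨L, hL⟩ := exists_lipschitz hb hper
  obtain ⟨Λ, hΛ, H⟩ := hG.exists_sum_sq_le
  -- `L` pays for replacing `c - a` by the image length; the rest is `one_add_mul_exp_sub_one_le`
  -- with `s = 2L|t|`.
  refine ⟨L + 2 * L + Λ * (2 * L), by positivity, fun p hp a c t hac => ?_⟩
  have hmono := strictMono_charFlow hb hper t
  have hAB := hmono hac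
  have hη := fun α => abs_charFlow_sub_affine_le hb hper hL hac.le
    (θ := (1 + ξ α) / 2) (by linarith [(hG.node_mem α).1]) (by linarith [(hG.node_mem α).2]) t
  have h1 := H p hp _ _ hAB (fun α => charFlow b (a + (1 + ξ α) / 2 * (c - a)) t) _
    (fun α => ⟨(hmono (hG.add_mul_mem hac α).1).le, (hmono (hG.add_mul_mem hac α).2).le⟩) hη
  have hI : 0 ≤ ∫ x in charFlow b a t..charFlow b c t, p.eval x ^ 2 :=
    intervalIntegral.integral_nonneg hAB.le fun x _ => sq_nonneg _
  have hca : c - a ≤ Real.exp (L * |t|) * (charFlow b c t - charFlow b a t) := by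
    have := mul_le_mul_of_nonneg_left (le_charFlow_sub hb hper hL hac.le t)
      (Real.exp_pos (L * |t|)).le
    rwa [mul_left_comm, ← Real.exp_add, add_neg_cancel, Real.exp_zero, mul_one] at this
  have hB := one_add_mul_exp_sub_one_le (s := 2 * (L * |t|)) hΛ (by positivity)
  rw [gaussSum]
  calc ∑ α, ω α / 2 * (c - a) * p.eval (charFlow b (a + (1 + ξ α) / 2 * (c - a)) t) ^ 2
      ≤ ∑ α, ω α / 2 * (Real.exp (L * |t|) * (charFlow b c t - charFlow b a t)) *
          p.eval (charFlow b (a + (1 + ξ α) / 2 * (c - a)) t) ^ 2 := by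
        refine Finset.sum_le_sum fun α _ => ?_
        have := (hG.weight_pos α).le
        gcongr
    _ = Real.exp (L * |t|) * ∑ α, ω α / 2 * (charFlow b c t - charFlow b a t) *
          p.eval (charFlow b (a + (1 + ξ α) / 2 * (c - a)) t) ^ 2 := by
        rw [Finset.mul_sum]
        exact Finset.sum_congr rfl fun α _ => by ring
    _ ≤ Real.exp (L * |t|) * (Real.exp (2 * (L * |t|)) * Real.exp (Λ * (2 * (L * |t|))) *
          ∫ x in charFlow b a t..charFlow b c t, p.eval x ^ 2) := by
        gcongr
        exact h1.trans (mul_le_mul_of_nonneg_right hB hI)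
    _ = _ := by
        rw [← mul_assoc, ← Real.exp_add, ← Real.exp_add]
        congr 2
        ring

end LocalStability

/-! ### The subdivision of a cell by the break points. -/

section CellPoints

variable {b : ℝ → ℝ} {dt : ℝ} {M i q : ℕ}

theorem mem_cellPoints (hb : ContDiff ℝ 1 b) (hper : Function.Periodic b 1) (hM : 1 ≤ M)
    {x : ℝ} : x ∈ cellPoints b dt M i ↔
      x = (i : ℝ) / M ∨ x = ((i : ℝ) + 1) / M ∨ x ∈ breakSet b dt M i := by
  rw [cellPoints, dif_pos (finite_breakSet hb hper dt hM i)]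
  simp

theorem cell_left_lt_right (hM : 1 ≤ M) (a : ℝ) : a / M < (a + 1) / M := by
  have : (0 : ℝ) < M := by exact_mod_cast hM
  gcongr
  linarith

theorem mem_Icc_of_mem_cellPoints (hb : ContDiff ℝ 1 b) (hper : Function.Periodic b 1)
    (hM : 1 ≤ M) {x : ℝ} (hx : x ∈ cellPoints b dt M i) :
    x ∈ Set.Icc ((i : ℝ) / M) (((i : ℝ) + 1) / M) := by
  have h := (cell_left_lt_right hM (i : ℝ)).le
  rcases (mem_cellPoints hb hper hM).1 hx with rfl | rfl | hx
  · exact Set.left_mem_Icc.2 h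
  · exact Set.right_mem_Icc.2 h
  · exact Set.Ioo_subset_Icc_self hx.1

theorem cellPoint_eq_orderEmbOfFin (hq : q < (cellPoints b dt M i).card) :
    cellPoint b dt M i q = (cellPoints b dt M i).orderEmbOfFin rfl ⟨q, hq⟩ := by
  rw [cellPoint, Finset.orderEmbOfFin_apply, List.getD_eq_getElem _ _ (by simpa using hq)]
  rfl

theorem cellPoint_mem (hq : q < (cellPoints b dt M i).card) :
    cellPoint b dt M i q ∈ cellPoints b dt M i := by
  rw [cellPoint_eq_orderEmbOfFin hq]
  exact Finset.orderEmbOfFin_mem _ _ _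

theorem cellPoint_lt_cellPoint {r : ℕ} (hqr : q < r) (hr : r < (cellPoints b dt M i).card) :
    cellPoint b dt M i q < cellPoint b dt M i r := by
  rw [cellPoint_eq_orderEmbOfFin hr, cellPoint_eq_orderEmbOfFin (hqr.trans hr)]
  exact (Finset.orderEmbOfFin _ _).strictMono hqr

theorem exists_cellPoint_eq {x : ℝ} (hx : x ∈ cellPoints b dt M i) :
    ∃ q < (cellPoints b dt M i).card, cellPoint b dt M i q = x := by
  have h : x ∈ Set.range ((cellPoints b dt M i).orderEmbOfFin rfl) := by
    rwa [Finset.range_orderEmbOfFin]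
  obtain ⟨⟨q, hq⟩, rfl⟩ := h
  exact ⟨q, hq, cellPoint_eq_orderEmbOfFin hq⟩

theorem cellPoint_zero (hb : ContDiff ℝ 1 b) (hper : Function.Periodic b 1) (hM : 1 ≤ M) :
    cellPoint b dt M i 0 = (i : ℝ) / M := by
  obtain ⟨q, hq, h⟩ := exists_cellPoint_eq ((mem_cellPoints (dt := dt) (i := i) hb hper hM).2
    (Or.inl rfl))
  rcases q.eq_zero_or_pos with rfl | hq0
  · exact h
  · have h1 := cellPoint_lt_cellPoint hq0 hq
    rw [h] at h1
    exact absurd (mem_Icc_of_mem_cellPoints hb hper hM (cellPoint_mem (hq0.trans hq))).1 h1.not_ge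

theorem cellPoint_last (hb : ContDiff ℝ 1 b) (hper : Function.Periodic b 1) (hM : 1 ≤ M) :
    cellPoint b dt M i ((cellPoints b dt M i).card - 1) = ((i : ℝ) + 1) / M := by
  obtain ⟨q, hq, h⟩ := exists_cellPoint_eq ((mem_cellPoints (dt := dt) (i := i) hb hper hM).2
    (Or.inr (Or.inl rfl)))
  rcases (Nat.le_sub_one_of_lt hq).eq_or_lt with hq0 | hq0
  · rw [← hq0, h]
  · have h1 := cellPoint_lt_cellPoint hq0 (Nat.sub_one_lt (Nat.ne_zero_of_lt hq))
    rw [h] at h1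
    exact absurd (mem_Icc_of_mem_cellPoints hb hper hM
      (cellPoint_mem (Nat.sub_one_lt (Nat.ne_zero_of_lt hq)))).2 h1.not_ge

theorem not_mem_cellPoints_of_mem_Ioo {x : ℝ} (hq : q + 1 < (cellPoints b dt M i).card)
    (hx : x ∈ Set.Ioo (cellPoint b dt M i q) (cellPoint b dt M i (q + 1))) :
    x ∉ cellPoints b dt M i := fun h => by
  obtain ⟨r, hr, rfl⟩ := exists_cellPoint_eq h
  rcases Nat.lt_or_ge r (q + 1) with h1 | h1
  · rcases (Nat.le_of_lt_succ h1).eq_or_lt with rfl | h2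
    · exact lt_irrefl _ hx.1
    · exact lt_asymm hx.1 (cellPoint_lt_cellPoint h2 (by omega))
  · rcases h1.eq_or_lt with rfl | h2
    · exact lt_irrefl _ hx.2
    · exact lt_asymm hx.2 (cellPoint_lt_cellPoint h2 hr)

/-- Between two consecutive points the flow takes its values in a single cell of the mesh. -/
theorem exists_charFlow_cellPoint_mem_cell (hb : ContDiff ℝ 1 b) (hper : Function.Periodic b 1)
    (hM : 1 ≤ M) (hq : q + 1 < (cellPoints b dt M i).card) :
    ∃ ℓ : ℤ, (ℓ : ℝ) / M ≤ charFlow b (cellPoint b dt M i q) (-dt) ∧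
      charFlow b (cellPoint b dt M i (q + 1)) (-dt) ≤ ((ℓ : ℝ) + 1) / M := by
  have hM' : (0 : ℝ) < M := by exact_mod_cast hM
  set a := cellPoint b dt M i q
  set c := cellPoint b dt M i (q + 1)
  have hac : a < c := cellPoint_lt_cellPoint q.lt_succ_self hq
  -- The cell of the left foot. Were the right foot beyond its end, the intermediate value theorem
  -- would give a break point strictly between consecutive points.
  refine ⟨⌊M * charFlow b a (-dt)⌋, ?_, ?_⟩
  · rw [div_le_iff₀' hM']
    exact Int.floor_le _
  · by_contra! hlt
    have hgt : charFlow b a (-dt) < ((⌊M * charFlow b a (-dt)⌋ : ℝ) + 1) / M := by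
      rw [lt_div_iff₀' hM']
      exact Int.lt_floor_add_one _
    obtain ⟨x, hx, hxe⟩ := intermediate_value_Ioo hac.le
      (continuous_charFlow_left hb hper (-dt)).continuousOn ⟨hgt, hlt⟩
    refine not_mem_cellPoints_of_mem_Ioo hq hx ((mem_cellPoints hb hper hM).2 (Or.inr (Or.inr
      ⟨⟨?_, ?_⟩, ⌊M * charFlow b a (-dt)⌋ + 1, ?_⟩)))
    · exact (mem_Icc_of_mem_cellPoints hb hper hM (cellPoint_mem (by omega))).1.trans_lt hx.1
    · exact hx.2.trans_le (mem_Icc_of_mem_cellPoints hb hper hM (cellPoint_mem hq)).2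
    · push_cast
      exact hxe

/-- Telescoping; `g` is the identity for exactness of the Gauss form and the flow map for stability.
-/
theorem sum_integral_cellPoint (hb : ContDiff ℝ 1 b) (hper : Function.Periodic b 1)
    (hM : 1 ≤ M) (g : ℝ → ℝ) {f : ℝ → ℝ} (hf : ∀ a c, IntervalIntegrable f volume a c) :
    ∑ i ∈ Finset.range M, ∑ q ∈ Finset.range ((cellPoints b dt M i).card - 1),
      ∫ x in g (cellPoint b dt M i q)..g (cellPoint b dt M i (q + 1)), f x =
      ∫ x in g 0..g 1, f x := by
  have hM' : (M : ℝ) ≠ 0 := by exact_mod_cast (by omega : M ≠ 0)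
  have h1 : ∀ i ∈ Finset.range M, ∑ q ∈ Finset.range ((cellPoints b dt M i).card - 1),
      ∫ x in g (cellPoint b dt M i q)..g (cellPoint b dt M i (q + 1)), f x =
      ∫ x in g ((i : ℝ) / M)..g (((i + 1 : ℕ) : ℝ) / M), f x := fun i _ => by
    rw [intervalIntegral.sum_integral_adjacent_intervals
      (a := fun q => g (cellPoint b dt M i q)) fun _ _ => hf _ _, cellPoint_zero hb hper hM,
      cellPoint_last hb hper hM, Nat.cast_add_one]
  rw [Finset.sum_congr rfl h1, intervalIntegral.sum_integral_adjacent_intervals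
    (a := fun i : ℕ => g ((i : ℝ) / M)) fun _ _ => hf _ _, Nat.cast_zero, zero_div,
    div_self hM']

end CellPoints

/-! ### Bilinearity, positivity and Cauchy–Schwarz for the Gauss form. -/

section GaussForm

variable {k : ℕ} {ξ ω : Fin (k + 1) → ℝ} {b : ℝ → ℝ} {dt : ℝ} {M : ℕ}

theorem gaussForm_sub_left (f g φ : ℝ → ℝ) :
    gaussForm ξ ω b dt M (fun x => f x - g x) φ =
      gaussForm ξ ω b dt M f φ - gaussForm ξ ω b dt M g φ := by
  simp only [gaussForm, gaussSum, sub_mul, mul_sub, Finset.sum_sub_distrib]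

theorem gaussForm_add_left (f g φ : ℝ → ℝ) :
    gaussForm ξ ω b dt M (fun x => f x + g x) φ =
      gaussForm ξ ω b dt M f φ + gaussForm ξ ω b dt M g φ := by
  simp only [gaussForm, gaussSum, add_mul, mul_add, Finset.sum_add_distrib]

theorem cellPoint_le_succ {i q : ℕ} (hq : q ∈ Finset.range ((cellPoints b dt M i).card - 1)) :
    cellPoint b dt M i q ≤ cellPoint b dt M i (q + 1) := by
  have := Finset.mem_range.1 hq
  exact (cellPoint_lt_cellPoint q.lt_succ_self (by omega)).le

theorem IsGaussRule.gaussSum_mono (hG : IsGaussRule k ξ ω) {a c : ℝ} (hac : a ≤ c)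
    {f g : ℝ → ℝ} (h : ∀ x, f x ≤ g x) : gaussSum ξ ω a c f ≤ gaussSum ξ ω a c g :=
  Finset.sum_le_sum fun α _ => mul_le_mul_of_nonneg_left (h _)
    (mul_nonneg (half_pos (hG.weight_pos α)).le (sub_nonneg.2 hac))

theorem IsGaussRule.gaussSum_nonneg (hG : IsGaussRule k ξ ω) {a c : ℝ} (hac : a ≤ c)
    {f : ℝ → ℝ} (h : ∀ x, 0 ≤ f x) : 0 ≤ gaussSum ξ ω a c f :=
  Finset.sum_nonneg fun α _ => mul_nonneg
    (mul_nonneg (half_pos (hG.weight_pos α)).le (sub_nonneg.2 hac)) (h _)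

theorem IsGaussRule.gaussForm_mono (hG : IsGaussRule k ξ ω) {f g f' g' : ℝ → ℝ}
    (h : ∀ x, f x * g x ≤ f' x * g' x) :
    gaussForm ξ ω b dt M f g ≤ gaussForm ξ ω b dt M f' g' :=
  Finset.sum_le_sum fun _ _ => Finset.sum_le_sum fun _ hq =>
    hG.gaussSum_mono (cellPoint_le_succ hq) h

theorem IsGaussRule.gaussForm_sq_le (hG : IsGaussRule k ξ ω) (f g : ℝ → ℝ) :
    gaussForm ξ ω b dt M f g ^ 2 ≤ gaussForm ξ ω b dt M f f * gaussForm ξ ω b dt M g g := by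
  have hs := fun f : ℝ → ℝ => fun x => mul_self_nonneg (f x)
  refine Finset.sum_sq_le_sum_mul_sum_of_sq_le_mul _
    (fun i _ => Finset.sum_nonneg fun q hq => hG.gaussSum_nonneg (cellPoint_le_succ hq) (hs f))
    (fun i _ => Finset.sum_nonneg fun q hq => hG.gaussSum_nonneg (cellPoint_le_succ hq) (hs g))
    fun i _ => Finset.sum_sq_le_sum_mul_sum_of_sq_le_mul _
    (fun q hq => hG.gaussSum_nonneg (cellPoint_le_succ hq) (hs f))
    (fun q hq => hG.gaussSum_nonneg (cellPoint_le_succ hq) (hs g)) fun q hq => ?_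
  have hw : ∀ α, 0 ≤ ω α / 2 * (cellPoint b dt M i (q + 1) - cellPoint b dt M i q) := fun α =>
    mul_nonneg (half_pos (hG.weight_pos α)).le (sub_nonneg.2 (cellPoint_le_succ hq))
  exact Finset.sum_sq_le_sum_mul_sum_of_sq_le_mul _ (fun α _ => mul_nonneg (hw α) (hs f _))
    (fun α _ => mul_nonneg (hw α) (hs g _)) fun α _ => le_of_eq (by ring)

end GaussForm

/-! ### The Gauss form on `V_k`, and the one-step estimate. -/

section DGSpace

variable {k : ℕ} {ξ ω : Fin (k + 1) → ℝ} {b : ℝ → ℝ} {dt : ℝ} {M : ℕ} {φ ψ : ℝ → ℝ}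

/-- The flow may leave `(0,1)`, so every cell of the line is needed; translating by the integer `ℓ /
M` brings cell `ℓ` to cell `ℓ % M`. -/
theorem exists_polynomial_of_mem_dgSpace (hM : 1 ≤ M) (hφ : φ ∈ dgSpace k M) (ℓ : ℤ) :
    ∃ p : Polynomial ℝ, p.natDegree ≤ k ∧
      ∀ x ∈ Set.Ioo ((ℓ : ℝ) / M) (((ℓ : ℝ) + 1) / M), φ x = p.eval x := by
  have hM0 : (M : ℤ) ≠ 0 := by omega
  have hM' : (M : ℝ) ≠ 0 := by exact_mod_cast hM0
  have h1 : (((ℓ % M).toNat : ℕ) : ℤ) = ℓ % M := Int.toNat_of_nonneg (Int.emod_nonneg _ hM0)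
  have h2 : ℓ % M < M := Int.emod_lt_of_pos _ (by omega)
  obtain ⟨p, hp, hφp⟩ := hφ.2 (ℓ % M).toNat (by omega)
  obtain ⟨q, hq, hqe⟩ := exists_polynomial_comp_affine p 1 (-((ℓ / M : ℤ) : ℝ))
  refine ⟨q, hq.trans hp, fun x hx => ?_⟩
  have h3 : (((ℓ % M).toNat : ℕ) : ℝ) = (ℓ : ℝ) - M * ((ℓ / M : ℤ) : ℝ) := by
    have h4 : (((ℓ % M).toNat : ℕ) : ℤ) = ℓ - M * (ℓ / M) := by
      rw [h1]
      exact Int.emod_def _ _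
    exact_mod_cast congrArg (Int.cast : ℤ → ℝ) h4
  have h5 : φ (x - ((ℓ / M : ℤ) : ℝ)) = φ x := by
    simpa using hφ.1.sub_int_mul_eq (x := x) (ℓ / M)
  rw [hqe, one_mul, ← sub_eq_add_neg, ← h5]
  refine hφp _ ?_
  have e1 : ((ℓ : ℝ) - M * ((ℓ / M : ℤ) : ℝ)) / M = (ℓ : ℝ) / M - ((ℓ / M : ℤ) : ℝ) := by
    field_simp
  have e2 : ((ℓ : ℝ) - M * ((ℓ / M : ℤ) : ℝ) + 1) / M =
      ((ℓ : ℝ) + 1) / M - ((ℓ / M : ℤ) : ℝ) := by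
    field_simp
    ring
  rw [h3, e1, e2]
  exact ⟨by linarith [hx.1], by linarith [hx.2]⟩

theorem exists_polynomial_mul_of_mem_dgSpace (hM : 1 ≤ M) (hφ : φ ∈ dgSpace k M)
    (hψ : ψ ∈ dgSpace k M) (ℓ : ℤ) :
    ∃ p : Polynomial ℝ, p.natDegree ≤ 2 * k + 1 ∧
      ∀ x ∈ Set.Ioo ((ℓ : ℝ) / M) (((ℓ : ℝ) + 1) / M), φ x * ψ x = p.eval x := by
  obtain ⟨p, hp, hφp⟩ := exists_polynomial_of_mem_dgSpace hM hφ ℓ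
  obtain ⟨q, hq, hψq⟩ := exists_polynomial_of_mem_dgSpace hM hψ ℓ
  exact ⟨p * q, Polynomial.natDegree_mul_le.trans (by omega), fun x hx => by
    rw [hφp x hx, hψq x hx, Polynomial.eval_mul]⟩

theorem const_mem_dgSpace (c : ℝ) : (fun _ => c) ∈ dgSpace k M :=
  ⟨fun _ => rfl, fun _ _ => ⟨Polynomial.C c, by simp, by simp⟩⟩

theorem intervalIntegrable_mul_of_mem_dgSpace (hM : 1 ≤ M) (hφ : φ ∈ dgSpace k M)
    (hψ : ψ ∈ dgSpace k M) (a c : ℝ) :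
    IntervalIntegrable (fun x => φ x * ψ x) volume a c := by
  have hM' : (M : ℝ) ≠ 0 := by exact_mod_cast (by omega : M ≠ 0)
  have hcell : ∀ i < M, IntervalIntegrable (fun x => φ x * ψ x) volume ((i : ℝ) / M)
      (((i + 1 : ℕ) : ℝ) / M) := fun i _ => by
    obtain ⟨p, -, hp⟩ := exists_polynomial_mul_of_mem_dgSpace hM hφ hψ i
    refine (p.continuous.intervalIntegrable _ _).congr_uIoo fun x hx => ?_
    rw [Nat.cast_add_one, Set.uIoo_of_lt (cell_left_lt_right hM _)] at hx
    exact (hp x (by simpa using hx)).symm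
  have h := IntervalIntegrable.trans_iterate (a := fun i : ℕ => (i : ℝ) / M) hcell
  rw [Nat.cast_zero, zero_div, div_self hM'] at h
  exact (hφ.1.mul hψ.1).intervalIntegrable₀ one_ne_zero h a c

theorem aestronglyMeasurable_of_mem_dgSpace (hM : 1 ≤ M) (hφ : φ ∈ dgSpace k M) :
    AEStronglyMeasurable φ (volume.restrict (Set.Ioo (0 : ℝ) 1)) := by
  have h := intervalIntegrable_mul_of_mem_dgSpace hM hφ (const_mem_dgSpace 1) 0 1
  simp only [mul_one] at h
  exact h.1.aestronglyMeasurable.mono_measure (Measure.restrict_mono_set _ Set.Ioo_subset_Ioc_self)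

theorem memLp_of_mem_dgSpace (hM : 1 ≤ M) (hφ : φ ∈ dgSpace k M) :
    MemLp φ 2 (volume.restrict (Set.Ioo (0 : ℝ) 1)) := by
  rw [memLp_two_iff_integrable_sq (aestronglyMeasurable_of_mem_dgSpace hM hφ)]
  have h := (intervalIntegrable_mul_of_mem_dgSpace hM hφ hφ 0 1).1
  simp only [← sq] at h
  exact h.mono_set Set.Ioo_subset_Ioc_self

theorem l2Norm_sq (hM : 1 ≤ M) (hφ : φ ∈ dgSpace k M) :
    l2Norm φ ^ 2 = ∫ x in (0 : ℝ)..1, φ x * φ x := by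
  rw [l2Norm, lpNorm_eq_integral_norm_rpow_toReal two_ne_zero ENNReal.ofNat_ne_top
    (aestronglyMeasurable_of_mem_dgSpace hM hφ), intervalIntegral.integral_of_le zero_le_one,
    integral_Ioc_eq_integral_Ioo, ENNReal.toReal_ofNat, ← Real.rpow_natCast, ← Real.rpow_mul
      (integral_nonneg fun x => by positivity)]
  norm_num [sq]

theorem l2Norm_nonneg (f : ℝ → ℝ) : 0 ≤ l2Norm f := lpNorm_nonneg

theorem gaussSum_congr_Ioo (hG : IsGaussRule k ξ ω) {a c : ℝ} (hac : a < c) {f g : ℝ → ℝ}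
    (h : ∀ x ∈ Set.Ioo a c, f x = g x) : gaussSum ξ ω a c f = gaussSum ξ ω a c g :=
  Finset.sum_congr rfl fun α _ => by rw [h _ (hG.add_mul_mem hac α)]

/-- On each sub-interval the product is a polynomial of degree at most `2k`, and the nodes are
interior, so values at mesh points play no role. -/
theorem IsGaussRule.gaussForm_eq_integral (hG : IsGaussRule k ξ ω) (hb : ContDiff ℝ 1 b)
    (hper : Function.Periodic b 1) (hM : 1 ≤ M) (hφ : φ ∈ dgSpace k M) (hψ : ψ ∈ dgSpace k M) :
    gaussForm ξ ω b dt M φ ψ = ∫ x in (0 : ℝ)..1, φ x * ψ x := by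
  rw [gaussForm, ← sum_integral_cellPoint (b := b) (dt := dt) hb hper hM (fun x => x)
    (intervalIntegrable_mul_of_mem_dgSpace hM hφ hψ)]
  refine Finset.sum_congr rfl fun i _ => Finset.sum_congr rfl fun q hq => ?_
  have hq' : q + 1 < (cellPoints b dt M i).card := by
    have := Finset.mem_range.1 hq
    omega
  have hac := cellPoint_lt_cellPoint q.lt_succ_self hq'
  obtain ⟨p, hp, hpe⟩ := exists_polynomial_mul_of_mem_dgSpace hM hφ hψ i
  have hpe' : ∀ x ∈ Set.Ioo (cellPoint b dt M i q) (cellPoint b dt M i (q + 1)),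
      φ x * ψ x = p.eval x := fun x hx => hpe x <| by
    rw [Int.cast_natCast]
    exact ⟨(mem_Icc_of_mem_cellPoints hb hper hM (cellPoint_mem (by omega))).1.trans_lt hx.1,
      hx.2.trans_le (mem_Icc_of_mem_cellPoints hb hper hM (cellPoint_mem hq')).2⟩
  rw [gaussSum_congr_Ioo hG hac hpe', hG.gaussSum_eq_integral p hp]
  exact (intervalIntegral.integral_congr_Ioo_of_le hac.le hpe').symm

/-- The images of the sub-intervals tile `[y_0(-Δt), y_1(-Δt)]`, an interval of length one, over
which periodicity gives the integral over a period. -/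
theorem IsGaussRule.exists_gaussForm_charFlow_le (hG : IsGaussRule k ξ ω) (hb : ContDiff ℝ 1 b)
    (hper : Function.Periodic b 1) :
    ∃ c₁ : ℝ, 0 ≤ c₁ ∧ ∀ (dt : ℝ) (M : ℕ), 1 ≤ M → ∀ φ ∈ dgSpace k M,
      gaussForm ξ ω b dt M (fun x => φ (charFlow b x (-dt))) (fun x => φ (charFlow b x (-dt))) ≤
        Real.exp (c₁ * |dt|) * ∫ x in (0 : ℝ)..1, φ x * φ x := by
  obtain ⟨c₁, hc₁, H⟩ := hG.exists_gaussSum_charFlow_le hb hper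
  refine ⟨c₁, hc₁, fun dt M hM φ hφ => ?_⟩
  have hI := intervalIntegrable_mul_of_mem_dgSpace hM hφ hφ
  have h1 : ∫ x in (0 : ℝ)..1, φ x * φ x =
      ∫ x in charFlow b 0 (-dt)..charFlow b 1 (-dt), φ x * φ x := by
    have h2 := charFlow_add_one hb hper 0 (-dt)
    have h3 := (hφ.1.mul hφ.1).intervalIntegral_add_eq 0 (charFlow b 0 (-dt))
    rw [zero_add] at h2 h3
    rw [h2]
    exact h3
  rw [h1, ← sum_integral_cellPoint (b := b) (dt := dt) hb hper hM (fun x => charFlow b x (-dt))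
    hI, gaussForm, Finset.mul_sum]
  refine Finset.sum_le_sum fun i _ => ?_
  rw [Finset.mul_sum]
  refine Finset.sum_le_sum fun q hq => ?_
  have hq' : q + 1 < (cellPoints b dt M i).card := by
    have := Finset.mem_range.1 hq
    omega
  have hac := cellPoint_lt_cellPoint q.lt_succ_self hq'
  have hmono := strictMono_charFlow hb hper (-dt)
  obtain ⟨ℓ, hℓ1, hℓ2⟩ := exists_charFlow_cellPoint_mem_cell hb hper hM hq'
  obtain ⟨p, hp, hpe⟩ := exists_polynomial_of_mem_dgSpace hM hφ ℓ
  have h4 := H p hp _ _ (-dt) hac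
  rw [abs_neg] at h4
  rw [gaussSum_congr_Ioo hG hac (g := fun x => p.eval (charFlow b x (-dt)) ^ 2) fun x hx => by
    rw [hpe _ ⟨hℓ1.trans_lt (hmono hx.1), (hmono hx.2).trans_le hℓ2⟩, sq]]
  refine h4.trans (le_of_eq ?_)
  congr 1
  refine intervalIntegral.integral_congr_Ioo_of_le (hmono hac).le fun x hx => ?_
  rw [hpe x ⟨hℓ1.trans_lt hx.1, hx.2.trans_le hℓ2⟩, sq]

theorem gaussForm_self_le_of_abs_le (hG : IsGaussRule k ξ ω) (hb : ContDiff ℝ 1 b)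
    (hper : Function.Periodic b 1) (hM : 1 ≤ M) {r : ℝ → ℝ} {ε : ℝ} (hr : ∀ x, |r x| ≤ ε) :
    gaussForm ξ ω b dt M r r ≤ ε ^ 2 := by
  have h1 := hG.gaussForm_mono (b := b) (dt := dt) (M := M) (f := r) (g := r)
    (f' := fun _ => ε) (g' := fun _ => ε) fun x => by
      have := abs_le.1 (hr x)
      nlinarith
  rw [hG.gaussForm_eq_integral hb hper hM (const_mem_dgSpace ε) (const_mem_dgSpace ε)] at h1
  simpa [sq] using h1

/-- The error equation of one step and its consequence in the `L²` norm. -/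
theorem IsGaussRule.exists_l2Norm_step_le (hG : IsGaussRule k ξ ω) (hb : ContDiff ℝ 1 b)
    (hper : Function.Periodic b 1) :
    ∃ c₁ : ℝ, 0 ≤ c₁ ∧ ∀ (dt : ℝ) (M : ℕ), 1 ≤ M → ∀ u u' g g' : ℝ → ℝ,
      u ∈ dgSpace k M → g ∈ dgSpace k M → g' ∈ dgSpace k M → IsStep ξ ω b dt M u u' →
      ∀ ε : ℝ, 0 ≤ ε → (∀ x, |g (charFlow b x (-dt)) - g' x| ≤ ε) →
      l2Norm (u' - g') ≤ Real.exp (c₁ * |dt|) * l2Norm (u - g) + ε := by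
  obtain ⟨c₁, hc₁, H⟩ := hG.exists_gaussForm_charFlow_le hb hper
  -- Half, because the stability bound concerns squared norms.
  refine ⟨c₁ / 2, by positivity, fun dt M hM u u' g g' hu hg hg' hstep ε hε hr => ?_⟩
  have he := (dgSpace k M).sub_mem hu hg
  have he' := (dgSpace k M).sub_mem hstep.1 hg'
  set X := l2Norm (u' - g') with hX
  have hX0 : 0 ≤ X := l2Norm_nonneg _
  have hXX : gaussForm ξ ω b dt M (u' - g') (u' - g') = X ^ 2 := by
    rw [hX, l2Norm_sq hM he', hG.gaussForm_eq_integral hb hper hM he' he']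
  -- The error equation tested with the new error: the scheme rewrites the `u'` term, exactness the
  -- `g'` term.
  have hdec : X ^ 2 =
      gaussForm ξ ω b dt M (fun x => (u - g) (charFlow b x (-dt))) (u' - g') +
      gaussForm ξ ω b dt M (fun x => g (charFlow b x (-dt)) - g' x) (u' - g') := by
    rw [← gaussForm_add_left]
    simp only [Pi.sub_apply, sub_add_sub_cancel]
    rw [gaussForm_sub_left, ← hstep.2 _ he', hG.gaussForm_eq_integral hb hper hM hg' he',
      ← intervalIntegral.integral_sub
        (intervalIntegrable_mul_of_mem_dgSpace hM hstep.1 he' 0 1)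
        (intervalIntegrable_mul_of_mem_dgSpace hM hg' he' 0 1), hX, l2Norm_sq hM he']
    exact intervalIntegral.integral_congr fun x _ => by simp only [Pi.sub_apply]; ring
  have h1 : gaussForm ξ ω b dt M (fun x => (u - g) (charFlow b x (-dt))) (u' - g') ≤
      Real.exp (c₁ / 2 * |dt|) * l2Norm (u - g) * X := by
    refine le_of_sq_le_sq ?_ (mul_nonneg (mul_nonneg (Real.exp_pos _).le (l2Norm_nonneg _)) hX0)
    refine (hG.gaussForm_sq_le _ _).trans ?_
    rw [hXX, mul_pow, mul_pow, l2Norm_sq hM he, ← Real.exp_nat_mul]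
    refine mul_le_mul_of_nonneg_right ((H dt M hM _ he).trans (le_of_eq ?_)) (sq_nonneg X)
    congr 2
    push_cast
    ring
  have h2 : gaussForm ξ ω b dt M (fun x => g (charFlow b x (-dt)) - g' x) (u' - g') ≤ ε * X := by
    refine le_of_sq_le_sq ?_ (mul_nonneg hε hX0)
    refine (hG.gaussForm_sq_le _ _).trans ?_
    rw [hXX, mul_pow]
    exact mul_le_mul_of_nonneg_right (gaussForm_self_le_of_abs_le hG hb hper hM hr) (sq_nonneg X)
  rcases hX0.eq_or_lt with h0 | h0
  · rw [← h0]
    exact add_nonneg (mul_nonneg (Real.exp_pos _).le (l2Norm_nonneg _)) hε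
  · refine le_of_mul_le_mul_right ?_ h0
    linarith [sq X]

end DGSpace

/-! ### Approximation by `V_k`, a discrete Gronwall inequality, and the theorem. -/

section Convergence

theorem exists_dgSpace_approx {k M : ℕ} (hM : 1 ≤ M) {w : ℝ → ℝ} (hw : Function.Periodic w 1)
    {ε : ℝ} (H : ∀ a : ℝ, ∃ p : Polynomial ℝ, p.natDegree ≤ k ∧
      ∀ x ∈ Set.Icc a (a + 1 / M), |w x - p.eval x| ≤ ε) :
    ∃ g ∈ dgSpace k M, ∀ x, |g x - w x| ≤ ε := by
  have hM' : (0 : ℝ) < M := by exact_mod_cast hM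
  choose p hp hpw using H
  -- On each half-open cell, the polynomial attached to its left end. The bound then holds at every
  -- point, as the pointwise Gauss form requires.
  refine ⟨fun x => (p (((⌊M * Int.fract x⌋₊ : ℕ) : ℝ) / M)).eval (Int.fract x),
    ⟨fun x => by simp only [Int.fract_add_one], fun i hi => ⟨_, hp ((i : ℝ) / M), ?_⟩⟩,
    fun x => ?_⟩
  · intro x hx
    have h1 := (div_lt_iff₀' hM').1 hx.1
    have h2 := (lt_div_iff₀' hM').1 hx.2
    have h3 : Int.fract x = x := by
      rw [Int.fract_eq_self]
      have h4 : (i : ℝ) + 1 ≤ M := by exact_mod_cast hi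
      have h5 : ((i : ℝ) + 1) / M ≤ 1 := (div_le_one hM').2 h4
      have h6 : 0 ≤ (i : ℝ) / M := by positivity
      exact ⟨h6.trans hx.1.le, hx.2.trans_le h5⟩
    have h7 : ⌊(M : ℝ) * x⌋₊ = i := by
      rw [Nat.floor_eq_iff (i.cast_nonneg.trans h1.le)]
      exact ⟨h1.le, h2⟩
    simp only [h3, h7]
  · have h1 : w (Int.fract x) = w x := by
      have h := hw.sub_int_mul_eq (x := x) ⌊x⌋
      rwa [mul_one] at h
    have h2 : 0 ≤ (M : ℝ) * Int.fract x := mul_nonneg hM'.le (Int.fract_nonneg x)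
    rw [← h1, abs_sub_comm]
    refine hpw _ _ ⟨?_, ?_⟩
    · rw [div_le_iff₀' hM']
      exact Nat.floor_le h2
    · rw [← add_div, le_div_iff₀' hM']
      exact (Nat.lt_floor_add_one _).le

theorem l2Norm_le_of_abs_le {f : ℝ → ℝ} {ε : ℝ} (hε : 0 ≤ ε) (hf : ∀ x, |f x| ≤ ε) :
    l2Norm f ≤ ε := by
  by_cases h : AEStronglyMeasurable f (volume.restrict (Set.Ioo (0 : ℝ) 1))
  · rw [l2Norm, ← toReal_eLpNorm h]
    refine ENNReal.toReal_le_of_le_ofReal hε ?_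
    refine (eLpNorm_le_of_ae_bound (Filter.Eventually.of_forall hf)).trans ?_
    simp
  -- `lpNorm` is `0` here, so no measurability hypothesis is needed.
  · rw [l2Norm, lpNorm_of_not_aestronglyMeasurable h]
    exact hε

theorem memLp_of_continuous {f : ℝ → ℝ} (hf : Continuous f) :
    MemLp f 2 (volume.restrict (Set.Ioo (0 : ℝ) 1)) := by
  rw [memLp_two_iff_integrable_sq hf.aestronglyMeasurable]
  exact ((hf.pow 2).integrableOn_Icc (a := 0) (b := 1)).mono_set Set.Ioo_subset_Icc_self

theorem le_of_recurrence {c δ ε : ℝ} (hc : 0 ≤ c * δ) (hε : 0 ≤ ε) {e : ℕ → ℝ} {N : ℕ}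
    (h : ∀ n < N, e (n + 1) ≤ Real.exp (c * δ) * e n + ε) {n : ℕ} (hn : n ≤ N) :
    e n ≤ Real.exp (c * (n * δ)) * (e 0 + n * ε) := by
  induction n with
  | zero => simp
  | succ n ih =>
    have h1 := mul_le_mul_of_nonneg_left (ih (by omega)) (Real.exp_pos (c * δ)).le
    rw [← mul_assoc, ← Real.exp_add, show c * δ + c * (n * δ) = c * ((n + 1 : ℕ) * δ) by
      push_cast; ring] at h1
    have h2 : 1 ≤ Real.exp (c * ((n + 1 : ℕ) * δ)) := Real.one_le_exp (by
      rw [mul_left_comm]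
      positivity)
    have h3 := mul_le_mul_of_nonneg_right h2 hε
    have h4 := h n (by omega)
    push_cast at *
    linarith

theorem ExpRegular.exists_dgSpace_approx {k : ℕ} {d : ℝ} (hd : 0 ≤ d) {w : ℝ → ℝ → ℝ}
    (hw : ExpRegular d (k + 1) w) (hper : ∀ t, Function.Periodic (w t) 1) :
    ∃ C : ℝ, 0 ≤ C ∧ ∀ T t : ℝ, |t| ≤ T → ∀ M : ℕ, 1 ≤ M → ∃ g ∈ dgSpace k M,
      ∀ x, |g x - w t x| ≤ C * Real.exp (d * T) * (1 / M) ^ (k + 1) := by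
  obtain ⟨C, hC, H⟩ := hw.exists_polynomial_approx
  refine ⟨C, hC, fun T t ht M hM => SLDG.exists_dgSpace_approx hM (hper t) fun a => ?_⟩
  obtain ⟨p, hp, hpw⟩ := H t a (1 / M) (by positivity)
  refine ⟨p, Polynomial.natDegree_le_of_degree_le (Order.le_of_lt_succ ?_),
    fun x hx => (hpw x hx).trans (by gcongr)⟩
  exact_mod_cast hp

end Convergence

end SLDG

theorem mainTheorem1 (k : ℕ) (ξ ω : Fin (k + 1) → ℝ) (hG : SLDG.IsGaussRule k ξ ω)
    (b : ℝ → ℝ) (hb : ContDiff ℝ ((2 * k + 2 : ℕ) : WithTop ℕ∞) b)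
    (hbper : Function.Periodic b 1) :
    ∃ C₁ : ℝ, 0 ≤ C₁ ∧
      ∀ v₀ : ℝ → ℝ, ContDiff ℝ ((k + 1 : ℕ) : WithTop ℕ∞) v₀ → Function.Periodic v₀ 1 →
      ∃ C : ℝ, 0 ≤ C ∧
        ∀ T : ℝ, 0 < T → ∀ v : ℝ → ℝ → ℝ, SLDG.IsSolution b v₀ T v →
        ∀ N M : ℕ, 1 ≤ N → 1 ≤ M → ∀ u : ℕ → ℝ → ℝ, u 0 ∈ SLDG.dgSpace k M →
        (∀ n < N, SLDG.IsStep ξ ω b (T / N) M (u n) (u (n + 1))) →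
        ∀ n ≤ N,
          SLDG.l2Norm (fun x => u n x - v (n * (T / N)) x) ≤
            Real.exp (C₁ * T) * (SLDG.l2Norm (fun x => u 0 x - v 0 x) +
              C * T * ((1 / M : ℝ) ^ (k + 1) / (T / N))) := by
  have hb1 : ContDiff ℝ 1 b := hb.of_le (by exact_mod_cast (by omega : 1 ≤ 2 * k + 2))
  have hbk : ContDiff ℝ ((k + 1 : ℕ) : WithTop ℕ∞) b :=
    hb.of_le (by exact_mod_cast (by omega : k + 1 ≤ 2 * k + 2))
  obtain ⟨c₁, hc₁, hstab⟩ := hG.exists_l2Norm_step_le hb1 hbper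
  obtain ⟨c, hc, hψ⟩ := SLDG.exists_expRegular_flowDeriv hbk hbper
  obtain ⟨d, hd, hreg⟩ := SLDG.exists_expRegular_comp_charFlow hb1 hbper hc hψ
  -- `c₁` is the stability rate; `d` absorbs the growth of `ε` with `T`.
  refine ⟨c₁ + d, by positivity, fun v₀ hv₀ hv₀per => ?_⟩
  obtain ⟨C, hC, happrox⟩ := (hreg v₀ hv₀ hv₀per).exists_dgSpace_approx hd fun t x => by
    rw [SLDG.charFlow_add_one hb1 hbper, hv₀per]
  -- `2N` errors `ε` come from the steps and two from passing between `v` and `g` at times `0` and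
  -- `n`; `2N + 2 ≤ 4N`, and `N = T / δ`.
  refine ⟨4 * C, by positivity, fun T hT v hv N M hN hM u hu hstep n hn => ?_⟩
  have hN' : (1 : ℝ) ≤ N := by exact_mod_cast hN
  set δ := T / N with hδ
  have hδ0 : 0 < δ := by positivity
  have hNδ : N * δ = T := by rw [hδ]; field_simp
  set ε := C * Real.exp (d * T) * (1 / M : ℝ) ^ (k + 1) with hε
  have hε0 : 0 ≤ ε := by positivity
  have htime : ∀ n ≤ N, (n : ℝ) * δ ∈ Set.Icc 0 T := fun n hn => by
    refine ⟨by positivity, ?_⟩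
    rw [← hNδ]
    gcongr
  have hveq : ∀ n ≤ N, ∀ x, v (n * δ) x = v₀ (SLDG.charFlow b x (-(n * δ))) := fun n hn x =>
    hv.eq_comp_charFlow hb1 hbper (htime n hn) x
  have hex : ∀ n, ∃ g, n ≤ N → g ∈ SLDG.dgSpace k M ∧ ∀ x, |g x - v (n * δ) x| ≤ ε := fun n => by
    by_cases hn : n ≤ N
    · obtain ⟨g, hg, hgv⟩ := happrox T (-(n * δ))
        (by rw [abs_neg, abs_of_nonneg (htime n hn).1]; exact (htime n hn).2) M hM
      exact ⟨g, fun _ => ⟨hg, fun x => by rw [hveq n hn]; exact hgv x⟩⟩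
    · exact ⟨0, fun h => absurd h hn⟩
  choose g hg using hex
  have huM : ∀ n ≤ N, u n ∈ SLDG.dgSpace k M := fun n hn => by
    cases n with
    | zero => exact hu
    | succ n => exact (hstep n hn).1
  have hrec : ∀ n < N, SLDG.l2Norm (u (n + 1) - g (n + 1)) ≤
      Real.exp (c₁ * δ) * SLDG.l2Norm (u n - g n) + 2 * ε := fun n hn => by
    have h1 := hstab δ M hM (u n) (u (n + 1)) (g n) (g (n + 1)) (huM n hn.le) (hg n hn.le).1
      (hg (n + 1) hn).1 (hstep n hn) (2 * ε) (by positivity) fun x => by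
        -- Transport along characteristics, so only the approximation errors of `g n` at the foot
        -- and of `g (n + 1)` at `x` remain.
        have e1 : v (n * δ) (SLDG.charFlow b x (-δ)) = v ((n + 1 : ℕ) * δ) x := by
          rw [hveq n hn.le, hveq (n + 1) hn, ← SLDG.charFlow_add hb1 hbper]
          push_cast
          ring_nf
        have h2 := (hg n hn.le).2 (SLDG.charFlow b x (-δ))
        have h3 := (hg (n + 1) hn).2 x
        rw [e1] at h2
        rw [abs_le] at *
        constructor <;> linarith
    rwa [abs_of_pos hδ0] at h1
  have hcont : ∀ n ≤ N, Continuous (v (n * δ)) := fun n hn => by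
    rw [funext (hveq n hn)]
    exact hv₀.continuous.comp (SLDG.continuous_charFlow_left hb1 hbper _)
  have hfin : SLDG.l2Norm (u n - v (n * δ)) ≤ SLDG.l2Norm (u n - g n) + ε :=
    (lpNorm_sub_le_lpNorm_sub_add_lpNorm_sub (SLDG.memLp_of_mem_dgSpace hM (huM n hn))
      (SLDG.memLp_of_mem_dgSpace hM (hg n hn).1) one_le_two).trans
      (add_le_add_right (SLDG.l2Norm_le_of_abs_le hε0 (hg n hn).2) _)
  have hini : SLDG.l2Norm (u 0 - g 0) ≤ SLDG.l2Norm (u 0 - v 0) + ε := by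
    have h0 := hcont 0 N.zero_le
    have h1 := (hg 0 N.zero_le).2
    rw [Nat.cast_zero, zero_mul] at h0 h1
    exact (lpNorm_sub_le_lpNorm_sub_add_lpNorm_sub (SLDG.memLp_of_mem_dgSpace hM hu)
      (SLDG.memLp_of_continuous h0) one_le_two).trans
      (add_le_add_right (SLDG.l2Norm_le_of_abs_le hε0 fun x => by
        rw [Pi.sub_apply, abs_sub_comm]; exact h1 x) _)
  have hmain := SLDG.le_of_recurrence (e := fun n => SLDG.l2Norm (u n - g n)) (by positivity)
    (by positivity) hrec hn
  set E₀ := SLDG.l2Norm (u 0 - v 0)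
  have hE₀ : 0 ≤ E₀ := SLDG.l2Norm_nonneg _
  have hexp : Real.exp (c₁ * (n * δ)) ≤ Real.exp (c₁ * T) := by
    gcongr
    exact (htime n hn).2
  have hnN : (n : ℝ) ≤ N := by exact_mod_cast hn
  have h1T : 1 ≤ Real.exp (c₁ * T) := Real.one_le_exp (by positivity)
  have h1d : 1 ≤ Real.exp (d * T) := Real.one_le_exp (by positivity)
  have hCT : 4 * C * T * ((1 / M : ℝ) ^ (k + 1) / δ) = 4 * N * (C * (1 / M : ℝ) ^ (k + 1)) := by
    rw [← hNδ]
    field_simp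
  change SLDG.l2Norm (u n - v (n * δ)) ≤ Real.exp ((c₁ + d) * T) *
    (E₀ + 4 * C * T * ((1 / M : ℝ) ^ (k + 1) / δ))
  calc SLDG.l2Norm (u n - v (n * δ))
      ≤ Real.exp (c₁ * (n * δ)) * (SLDG.l2Norm (u 0 - g 0) + n * (2 * ε)) + ε :=
        hfin.trans (add_le_add_left hmain _)
    _ ≤ Real.exp (c₁ * T) * (E₀ + ε + N * (2 * ε)) + Real.exp (c₁ * T) * ε := by
        refine add_le_add ?_ (le_mul_of_one_le_left hε0 h1T)
        have h0 := SLDG.l2Norm_nonneg (u 0 - g 0)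
        gcongr
    _ = Real.exp (c₁ * T) * (E₀ + (2 * N + 2) * ε) := by ring
    _ ≤ Real.exp (c₁ * T) * (Real.exp (d * T) * E₀ + 4 * N * ε) := by
        gcongr
        · exact le_mul_of_one_le_left hE₀ h1d
        · linarith
    _ = Real.exp ((c₁ + d) * T) * (E₀ + 4 * C * T * ((1 / M : ℝ) ^ (k + 1) / δ)) := by
        rw [hCT, add_mul, Real.exp_add, hε]
        ring
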